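/- **Model.** A cache holds at most $k\ge 1$ pages. To process a request, the requested page must be in the cache; every page brought into the cache costs $1$. Requests are drawn independently from pages $1,\dots,m$ according to probabilities $p_1\ge\dots\ge p_m$. $\mathrm{OPT}$ is the optimal offline solution (started from the same initial cache as the algorithm it is compared with), $\mathrm{LRU}$ (started with an empty cache) evicts at a page fault with full cache the least recently requested page, and $\mathrm{PLFU}$ keeps the $k$ most popular pages $1,\dots,k$ in the cache: at a page fault page $k$ is replaced by the requested page, and right after the request page $k$ is put back, at a total cost of $2$. For $\mathrm{ALG}\in\{\mathrm{LRU},\mathrm{PLFU}\}$, $$\mathrm{RoE}(\mathrm{ALG})=\limsup_{n\to\infty}\frac{\mathbb E[\mathrm{ALG}(\sigma)]}{\mathbb E[\mathrm{OPT}(\sigma)]},$$ where $\sigma$ is a sequence of $n$ random requests. **Theorem.** Let $\alpha>0$ and, for every $m$, let $p_i=\frac{1}{L(\alpha,m)}\,i^{-\alpha}$ for $1\le i\le m$, with $L(\alpha,m)=\sum_{i=1}^m i^{-\alpha}$. For real $x,y$ let $p[x:y]$ be the sum of the $p_i$ over the integers $i$ with $x\le i\le y$, and put $$F(k,m)=\min\left\{\frac{p[\frac{3k}{8}:\frac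 k2]+p[\frac{3k}{2}:m]}{p[\frac{3k}{8}:m]},\ \frac{p[\frac{11k}{8}:m]}{p[\frac k2:m]}\right\}.$$ Define $$f(\alpha)=\begin{cases}\min\left\{1-\dfrac{2^{\alpha-1}-(\frac23)^{\alpha-1}}{(\frac83)^{\alpha-1}-(\frac12)^{\alpha-1}},\ \dfrac{(\frac43)^{\alpha-1}-1}{4^{\alpha-1}-1}\right\}&\text{if }\alpha>1,\\[3mm] 2-\dfrac{\log 11}{\log 4}&\text{if }\alpha=1,\\[2mm] 1-\dfrac{3^{1-\alpha}-1}{4^{1-\alpha}-1}&\text{if }0<\alpha<1.\end{cases}$$ Then: 1. $f(\alpha)>0$, and $F(k,m)\ge f(\alpha)$ for all $k\ge1$ divisible by $8$ and all $m\ge 2k$. 2. There is a constant $c>0$ depending only on $\alpha$ such that $F(k,m)\ge c$ for all $k\ge 1$ (divisible by $8$ or not) and all $m\ge 2k$. 3. $\mathrm{RoE}(\mathrm{LRU})=O(1)$ and $\mathrm{RoE}(\mathrm{PLFU})=O(1)$: for each of the two algorithms there is a constant $C$ depending only on $\alpha$ such that its ratio of expectations is at most $C$ for all $k\ge1$ and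 all $m\ge 2k$. -/

import Mathlib

namespace Paging

open Filter

/-! ### The paging problem -/

/-- `Serves k C σ c`: starting with cache content `C`, the request sequence `σ` can be processed
with a cache of size `k` at total cost `c`. Processing a request `r` means passing to a cache
content `S` (at most `k` pages) that contains `r`, and then, before the next request, possibly to
another cache content `C'`; every page brought into the cache costs `1`. -/
inductive Serves {M : Type*} [DecidableEq M] (k : ℕ) : Finset M → List M → ℕ → Prop
  | nil (C : Finset M) : Serves k C [] 0
  | cons (C S C' : Finset M) (r : M) (σ : List M) (c : ℕ)
      (hr : r ∈ S) (hS : S.card ≤ k) (hC' : C'.card ≤ k) (h : Serves k C' σ c) :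
      Serves k C (r :: σ) ((S \ C).card + (C' \ S).card + c)

/-- The cost of the optimal offline solution `OPT` on `σ`, from initial cache content `C`. -/
noncomputable def optCost {M : Type*} [DecidableEq M] (k : ℕ) (C : Finset M) (σ : List M) : ℕ :=
  sInf {c | Serves k C σ c}

/-- The cache of `LRU` is kept as a list, the most recently requested page first. On a hit the
requested page moves to the front; on a fault it is put in front and, if the cache was full, the
last page of the list (the least recently requested one) is evicted. -/
def lruStep {M : Type*} [DecidableEq M] (k : ℕ) (l : List M) (r : M) : List M :=
  if r ∈ l then r :: l.erase r else (r :: l).take k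

/-- The cost of `LRU` (the number of page faults) on a sequence, from the cache list `l`. -/
def lruCost {M : Type*} [DecidableEq M] (k : ℕ) : List M → List M → ℕ
  | _, [] => 0
  | l, r :: σ => (if r ∈ l then 0 else 1) + lruCost k (lruStep k l r) σ

/-- Pages are labelled by popularity: `j : Fin m` is the `(j + 1)`-st most popular page.
These are the `k` most popular pages. -/
def topPages (m k : ℕ) : Finset (Fin m) := Finset.univ.filter fun j => (j : ℕ) < k

/-- The cache content with which `PLFU` processes a request to `r`: on a fault the `k`-th most
popular page makes room for `r`. -/
def plfuServe (m k : ℕ) (r : Fin m) : Finset (Fin m) :=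
  if r ∈ topPages m k then topPages m k else insert r (topPages m (k - 1))

/-- The cost of `PLFU`: before and after every request the cache consists of the `k` most popular
pages, so it pays for passing to `plfuServe m k r` and for passing back. -/
def plfuCost (m k : ℕ) : List (Fin m) → ℕ
  | [] => 0
  | r :: σ => (plfuServe m k r \ topPages m k).card + (topPages m k \ plfuServe m k r).card
      + plfuCost m k σ

/-! ### The stochastic input model -/

/-- Expectation of `f σ` for a sequence `σ` of `n` independent requests, each of them being
page `j` with probability `π j`. -/
noncomputable def expCost {m : ℕ} (π : Fin m → ℝ) (n : ℕ) (f : List (Fin m) → ℕ) : ℝ :=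
  ∑ σ : Fin n → Fin m, (∏ t, π (σ t)) * (f (List.ofFn σ) : ℝ)

/-- The limsup, as `n → ∞`, of the ratio of the expected costs on `n` random requests. -/
noncomputable def ratioOfExpectations {m : ℕ} (π : Fin m → ℝ) (alg opt : List (Fin m) → ℕ) :
    ENNReal :=
  limsup (fun n : ℕ => ENNReal.ofReal (expCost π n alg) / ENNReal.ofReal (expCost π n opt)) atTop

/-- `RoE(LRU)`, starting with an empty cache. -/
noncomputable def roeLRU {m : ℕ} (π : Fin m → ℝ) (k : ℕ) : ENNReal :=
  ratioOfExpectations π (lruCost k []) (optCost k ∅)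

/-- `RoE(PLFU)`, starting with the `k` most popular pages in the cache. -/
noncomputable def roePLFU {m : ℕ} (π : Fin m → ℝ) (k : ℕ) : ENNReal :=
  ratioOfExpectations π (plfuCost m k) (optCost k (topPages m k))

/-! ### Power laws -/

/-- The normalization `L(α, m) = ∑_{i = 1}^m 1 / i ^ α`. -/
noncomputable def powerNorm (α : ℝ) (m : ℕ) : ℝ := ∑ i ∈ Finset.Icc 1 m, 1 / (i : ℝ) ^ α

/-- The probability `p_i` of the `i`-th most popular page, `1 ≤ i ≤ m`. -/
noncomputable def powerProb (α : ℝ) (m : ℕ) (i : ℕ) : ℝ := 1 / powerNorm α m * (1 / (i : ℝ) ^ α)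

/-- The power-law distribution on the `m` pages. -/
noncomputable def powerLaw (α : ℝ) (m : ℕ) (j : Fin m) : ℝ := powerProb α m (j + 1)

/-- `p[x : y]`, the sum of `p i` over the integers `i` with `x ≤ i ≤ y`. -/
noncomputable def segSum (p : ℕ → ℝ) (x y : ℝ) : ℝ := ∑ i ∈ Finset.Icc ⌈x⌉₊ ⌊y⌋₊, p i

/-- `min {(p[3k/8 : k/2] + p[3k/2 : m]) / p[3k/8 : m], p[11k/8 : m] / p[k/2 : m]}`. -/
noncomputable def minExpr (p : ℕ → ℝ) (k m : ℕ) : ℝ :=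
  min ((segSum p (3 * k / 8) (k / 2) + segSum p (3 * k / 2) m) / segSum p (3 * k / 8) m)
    (segSum p (11 * k / 8) m / segSum p (k / 2) m)

/-- The explicit lower bound, a function of `α` alone (used for `α > 0`). -/
noncomputable def lowerBound (α : ℝ) : ℝ :=
  if 1 < α then
    min (1 - ((2 : ℝ) ^ (α - 1) - (2 / 3 : ℝ) ^ (α - 1)) /
          ((8 / 3 : ℝ) ^ (α - 1) - (1 / 2 : ℝ) ^ (α - 1)))
      (((4 / 3 : ℝ) ^ (α - 1) - 1) / ((4 : ℝ) ^ (α - 1) - 1))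
  else if α = 1 then 2 - Real.log 11 / Real.log 4
  else 1 - ((3 : ℝ) ^ (1 - α) - 1) / ((4 : ℝ) ^ (1 - α) - 1)

end Paging

/-! Both competitive bounds compare with $n q$, where $q$ is the probability of a request outside
the $k$ most popular pages.

OPT is at least a constant times $nq$ for large $n$. Cut the sequence into windows of $N\approx
Ak/q$ requests. Whatever the cache holds when a window starts, serving $D$ distinct pages costs at
least $D-k$ (`card_add_freeOptCost_le`), and for power laws a window contains at least $3k/2$
distinct pages on average (`le_sum_one_sub_pow`), so it costs at least $k/2$ in expectation.

PLFU pays at most 2 for each request outside the top $k$. For LRU, a potential argument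
(`mul_lruCost_le`) charges faults on the top $\lfloor k/2\rfloor$ pages to requests outside that
set; the tail after $\lfloor k/2\rfloor$ is at most a constant times $q$ (`tailProb_half_le`).

The bounds on $F$ are independent of this. The uniform one compares single probabilities at indices
within a constant factor of each other. For $k=8j$ the sums are compared with integrals of
$x^{-\alpha}$, whose scaling removes $j$. The second quotient needs the midpoint inequality for
convex functions, a separate treatment of $j=1$, and a sharper estimate at $\alpha=1$, where the
claimed value exceeds what the general argument gives. -/

namespace Paging

open Filter

/-! ### Expectations over random request sequences -/

/-- Expectation of `g σ` for a list `σ` of `n` independent samples of `π`, computed request by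
request. -/
noncomputable def listExp {M : Type*} [Fintype M] (π : M → ℝ) : ℕ → (List M → ℝ) → ℝ
  | 0, g => g []
  | n + 1, g => ∑ r, π r * listExp π n fun σ => g (r :: σ)

theorem expCost_eq_listExp {m : ℕ} (π : Fin m → ℝ) (n : ℕ) (f : List (Fin m) → ℕ) :
    expCost π n f = listExp π n fun σ => (f σ : ℝ) := by
  induction n generalizing f with
  | zero => simp [expCost, listExp]
  | succ n ih =>
    have h : ∀ r, (listExp π n fun σ => (f (r :: σ) : ℝ)) = expCost π n fun σ => f (r :: σ) :=
      fun r => (ih _).symm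
    simp only [listExp, h]
    unfold expCost
    rw [← (Fin.consEquiv fun _ : Fin (n + 1) => Fin m).sum_comp, Fintype.sum_prod_type]
    refine Finset.sum_congr rfl fun r _ => ?_
    rw [Finset.mul_sum]
    refine Finset.sum_congr rfl fun σ _ => ?_
    simp [Fin.consEquiv, Fin.prod_univ_succ, List.ofFn_succ, mul_assoc]

section listExp

variable {M : Type*} [Fintype M] {π : M → ℝ}

theorem listExp_mono (hπ : ∀ r, 0 ≤ π r) (n : ℕ) {g g' : List M → ℝ} (h : ∀ σ, g σ ≤ g' σ) :
    listExp π n g ≤ listExp π n g' := by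
  induction n generalizing g g' with
  | zero => exact h []
  | succ n ih =>
    exact Finset.sum_le_sum fun r _ => mul_le_mul_of_nonneg_left (ih fun σ => h _) (hπ r)

theorem listExp_const (hπ : ∑ r, π r = 1) (n : ℕ) (c : ℝ) : listExp π n (fun _ => c) = c := by
  induction n with
  | zero => rfl
  | succ n ih => simp only [listExp, ih, ← Finset.sum_mul, hπ, one_mul]

theorem listExp_add (π : M → ℝ) (n : ℕ) (g g' : List M → ℝ) :
    listExp π n (fun σ => g σ + g' σ) = listExp π n g + listExp π n g' := by
  induction n generalizing g g' with
  | zero => rfl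
  | succ n ih => simp only [listExp, ih, mul_add, Finset.sum_add_distrib]

theorem listExp_const_mul (π : M → ℝ) (n : ℕ) (c : ℝ) (g : List M → ℝ) :
    listExp π n (fun σ => c * g σ) = c * listExp π n g := by
  induction n generalizing g with
  | zero => rfl
  | succ n ih => simp only [listExp, ih, Finset.mul_sum, mul_left_comm]

theorem listExp_sum (π : M → ℝ) (n : ℕ) {ι : Type*} (s : Finset ι) (g : ι → List M → ℝ) :
    listExp π n (fun σ => ∑ i ∈ s, g i σ) = ∑ i ∈ s, listExp π n (g i) := by
  induction n generalizing g with
  | zero => rfl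
  | succ n ih =>
    simp only [listExp, ih, Finset.mul_sum]
    exact Finset.sum_comm

theorem listExp_append (π : M → ℝ) (a b : ℕ) (g : List M → ℝ) :
    listExp π (a + b) g = listExp π a fun σ => listExp π b fun τ => g (σ ++ τ) := by
  induction a generalizing g with
  | zero => simp [listExp]
  | succ a ih =>
    rw [Nat.succ_add_eq_add_succ, Nat.add_succ]
    simp only [listExp, ih, List.cons_append]

theorem listExp_countP (hπ : ∑ r, π r = 1) (n : ℕ) (p : M → Prop) [DecidablePred p] :
    listExp π n (fun σ => (σ.countP (fun r => decide (p r)) : ℝ)) = n * ∑ r with p r, π r := by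
  induction n with
  | zero => simp [listExp]
  | succ n ih =>
    simp only [listExp, List.countP_cons, Nat.cast_add, listExp_add, ih, listExp_const hπ, mul_add,
      Finset.sum_add_distrib, ← Finset.sum_mul, hπ, Finset.sum_filter]
    simp [add_mul]

theorem listExp_mem [DecidableEq M] (hπ : ∑ r, π r = 1) (n : ℕ) (j : M) :
    listExp π n (fun σ => if j ∈ σ then 1 else 0) = 1 - (1 - π j) ^ n := by
  induction n with
  | zero => simp [listExp]
  | succ n ih =>
    have h : ∀ r, (π r * listExp π n fun σ => if j ∈ r :: σ then (1 : ℝ) else 0) =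
        π r * (1 - (1 - π j) ^ n) + if r = j then π j * (1 - π j) ^ n else 0 := by
      intro r
      by_cases hr : r = j
      · subst hr
        simp only [List.mem_cons, true_or, if_true, listExp_const hπ]
        ring
      · simp [List.mem_cons, hr, Ne.symm hr, ih]
    simp only [listExp, h, Finset.sum_add_distrib, ← Finset.sum_mul, hπ]
    simp only [Finset.sum_ite_eq', Finset.mem_univ, if_true]
    ring

theorem listExp_card_toFinset [DecidableEq M] (hπ : ∑ r, π r = 1) (n : ℕ) :
    listExp π n (fun σ => (σ.toFinset.card : ℝ)) = ∑ j, (1 - (1 - π j) ^ n) := by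
  have h : ∀ σ : List M, (σ.toFinset.card : ℝ) = ∑ j, if j ∈ σ then (1 : ℝ) else 0 := by
    intro σ
    rw [Finset.sum_boole]
    congr 2
    ext j
    simp
  simp only [h, listExp_sum, listExp_mem hπ]

end listExp

/-! ### A lower bound for the optimal offline cost -/

section opt

variable {M : Type*} [DecidableEq M]

/-- The least cost of serving `σ` from any initial cache content. -/
noncomputable def freeOptCost (k : ℕ) (σ : List M) : ℕ :=
  sInf {c | ∃ C : Finset M, C.card ≤ k ∧ Serves k C σ c}

theorem exists_serves {k : ℕ} (hk : 1 ≤ k) (C : Finset M) (σ : List M) : ∃ c, Serves k C σ c := by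
  induction σ generalizing C with
  | nil => exact ⟨0, .nil C⟩
  | cons r σ ih =>
    obtain ⟨c, hc⟩ := ih {r}
    exact ⟨_, .cons C {r} {r} r σ c (by simp) (by simpa) (by simpa) hc⟩

theorem freeOptCost_le_optCost {k : ℕ} (hk : 1 ≤ k) {C : Finset M} (hC : C.card ≤ k)
    (σ : List M) : freeOptCost k σ ≤ optCost k C σ := by
  have h : Serves k C σ (optCost k C σ) := Nat.sInf_mem (exists_serves hk C σ)
  exact Nat.sInf_le ⟨C, hC, h⟩

theorem Serves.card_sdiff_le {k : ℕ} {C : Finset M} {σ : List M} {c : ℕ} (h : Serves k C σ c) :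
    (σ.toFinset \ C).card ≤ c := by
  induction h with
  | nil C => simp
  | cons C S C' r σ c hr hS hC' h ih =>
    have hsub : (r :: σ).toFinset \ C ⊆ (S \ C) ∪ (C' \ S) ∪ (σ.toFinset \ C') := by
      intro x
      simp only [List.toFinset_cons, Finset.mem_sdiff, Finset.mem_insert, Finset.mem_union]
      rintro ⟨rfl | hx, hxC⟩ <;> tauto
    calc _ ≤ _ := Finset.card_le_card hsub
      _ ≤ _ := Finset.card_union_le _ _
      _ ≤ _ := Nat.add_le_add (Finset.card_union_le _ _) ih

theorem Serves.append {k : ℕ} {C : Finset M} (hC : C.card ≤ k) {σ τ : List M} {c : ℕ}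
    (h : Serves k C (σ ++ τ) c) :
    ∃ C' c₁ c₂, C'.card ≤ k ∧ Serves k C σ c₁ ∧ Serves k C' τ c₂ ∧ c₁ + c₂ = c := by
  induction σ generalizing C c with
  | nil => exact ⟨C, 0, c, hC, .nil C, h, by simp⟩
  | cons r σ ih =>
    cases h with
    | cons _ S C' _ _ c hr hS hC' h =>
      obtain ⟨C'', c₁, c₂, h₁, h₂, h₃, h₄⟩ := ih hC' h
      exact ⟨C'', _, c₂, h₁, .cons C S C' r σ c₁ hr hS hC' h₂, h₃, by omega⟩

/-- An optimal schedule is cut after `σ`: its first part loads every distinct page of `σ` missing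
from an initial cache of at most $k$ pages, and its second part starts from some legal cache.
Leaving the initial cache free is what allows iteration over windows. -/
theorem card_add_freeOptCost_le {k : ℕ} (hk : 1 ≤ k) (σ τ : List M) :
    σ.toFinset.card + freeOptCost k τ ≤ k + freeOptCost k (σ ++ τ) := by
  obtain ⟨c₀, hc₀⟩ := exists_serves hk ∅ (σ ++ τ)
  have hne : {c | ∃ C : Finset M, C.card ≤ k ∧ Serves k C (σ ++ τ) c}.Nonempty :=
    ⟨c₀, ∅, by simp, hc₀⟩
  obtain ⟨C, hC, h⟩ := Nat.sInf_mem hne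
  obtain ⟨C', c₁, c₂, h₁, h₂, h₃, h₄⟩ := h.append hC
  have h5 : freeOptCost k τ ≤ c₂ := Nat.sInf_le ⟨C', h₁, h₃⟩
  have h6 := h₂.card_sdiff_le
  have h7 := Finset.le_card_sdiff C σ.toFinset
  change c₁ + c₂ = freeOptCost k (σ ++ τ) at h₄
  omega

/-- Each window contributes its expected number of distinct pages minus $k$; the remainder of `r`
requests is bounded below by zero. -/
theorem le_listExp_freeOptCost [Fintype M] {π : M → ℝ} (h0 : ∀ r, 0 ≤ π r) (h1 : ∑ r, π r = 1)
    {k : ℕ} (hk : 1 ≤ k) (N w r : ℕ) :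
    w * (∑ j, (1 - (1 - π j) ^ N) - k) ≤
      listExp π (w * N + r) fun σ => (freeOptCost k σ : ℝ) := by
  induction w with
  | zero =>
    rw [← listExp_const h1 (0 * N + r) (((0 : ℕ) : ℝ) * _)]
    exact listExp_mono h0 _ fun σ => by simp
  | succ w ih =>
    rw [show (w + 1) * N + r = N + (w * N + r) by ring, listExp_append]
    have h : ∀ σ : List M, (σ.toFinset.card : ℝ) + (w * (∑ j, (1 - (1 - π j) ^ N) - k) - k) ≤
        listExp π (w * N + r) fun τ => (freeOptCost k (σ ++ τ) : ℝ) := by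
      intro σ
      have h2 : (listExp π (w * N + r) fun τ => (σ.toFinset.card : ℝ) + freeOptCost k τ) ≤
          listExp π (w * N + r) fun τ => (k : ℝ) + freeOptCost k (σ ++ τ) :=
        listExp_mono h0 _ fun τ => by exact_mod_cast card_add_freeOptCost_le hk σ τ
      rw [listExp_add, listExp_add, listExp_const h1, listExp_const h1] at h2
      linarith
    have h3 := listExp_mono h0 N h
    rw [listExp_add, listExp_const h1, listExp_card_toFinset h1] at h3
    push_cast
    linarith

end opt

/-! ### An upper bound for the cost of `LRU` -/

theorem takeWhile_take_sublist {M : Type*} (p : M → Bool) (l : List M) (n : ℕ) :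
    ((l.take n).takeWhile p).Sublist (l.takeWhile p) := by
  induction l generalizing n with
  | nil => simp
  | cons y l ih =>
    cases n with
    | zero => simp
    | succ n => by_cases hp : p y <;> simp [hp, ih]

section lru

variable {M : Type*} [DecidableEq M]

/-- The number of pages outside `H` that are more recent than `x` in the cache list `l`, and `b`
if `x` is not in the cache. -/
def outsideBefore (H : Finset M) (b : ℕ) (l : List M) (x : M) : ℕ :=
  if x ∈ l then (l.takeWhile fun y => decide (y ≠ x)).countP fun y => decide (y ∉ H) else b

theorem nodup_lruStep (k : ℕ) {l : List M} (hl : l.Nodup) (r : M) : (lruStep k l r).Nodup := by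
  unfold lruStep
  split_ifs with h
  · exact List.nodup_cons.2 ⟨fun h' => (List.Nodup.mem_erase_iff hl).1 h' |>.1 rfl, hl.erase r⟩
  · exact (List.nodup_cons.2 ⟨h, hl⟩).sublist (List.take_sublist _ _)

theorem takeWhile_erase_sublist (p : M → Bool) (l : List M) {r : M} (hr : p r) :
    ((l.erase r).takeWhile p).Sublist (l.takeWhile p) := by
  induction l with
  | nil => simp
  | cons y l ih =>
    by_cases hy : y = r
    · subst hy
      simp [hr]
    · rw [List.erase_cons_tail (by simpa using hy)]
      by_cases hp : p y <;> simp [hp, ih]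

theorem le_length_takeWhile {l : List M} {x : M} {n : ℕ} (hx : x ∈ l) (hn : x ∉ l.take n) :
    n ≤ (l.takeWhile fun y => decide (y ≠ x)).length := by
  induction l generalizing n with
  | nil => simp at hx
  | cons y l ih =>
    cases n with
    | zero => simp
    | succ n =>
      simp only [List.take_succ_cons, List.mem_cons, not_or] at hn
      have hx' : x ∈ l := by
        rcases List.mem_cons.1 hx with h | h
        · exact absurd h hn.1
        · exact h
      have := ih hx' hn.2
      simp [Ne.symm hn.1] at this ⊢
      exact this

/-- A page about to be evicted has at least $k-1$ distinct pages in front of it, at most $|H|-1$ of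
which lie in $H$. -/
theorem le_countP_takeWhile {H : Finset M} {l : List M} (hl : l.Nodup) {x : M} (hxH : x ∈ H)
    {k : ℕ} (hx : x ∈ l) (hn : x ∉ l.take (k - 1)) :
    k - H.card ≤ (l.takeWhile fun y => decide (y ≠ x)).countP fun y => decide (y ∉ H) := by
  set t := l.takeWhile fun y => decide (y ≠ x) with ht
  have h1 : k - 1 ≤ t.length := le_length_takeWhile hx hn
  have h2 := t.length_eq_countP_add_countP fun y => decide (y ∉ H)
  have hnd : t.Nodup := hl.sublist (List.takeWhile_sublist _)
  have h3 : (t.countP fun y => ¬ (decide (y ∉ H)) = true) ≤ (H.erase x).card := by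
    rw [List.countP_eq_length_filter, ← List.toFinset_card_of_nodup (hnd.filter _)]
    refine Finset.card_le_card fun y hy => ?_
    simp only [List.mem_toFinset, List.mem_filter] at hy
    have := List.mem_takeWhile_imp hy.1
    simp at this hy ⊢
    exact ⟨this, hy.2⟩
  rw [Finset.card_erase_of_mem hxH] at h3
  have := Finset.card_pos.2 ⟨x, hxH⟩
  omega

/-- The potential of `x` grows by at most one per request outside $H$. Requesting `x` resets it to
zero, which on a fault releases the default value $k-|H|$. Eviction does not raise it, since the
count has then already reached $k-|H|$. -/
theorem outsideBefore_lruStep_le {H : Finset M} {k : ℕ} (hk : 1 ≤ k) {l : List M} (hl : l.Nodup)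
    {x : M} (hx : x ∈ H) (r : M) :
    outsideBefore H (k - H.card) (lruStep k l r) x +
        (if r = x ∧ r ∉ l then k - H.card else 0) ≤
      outsideBefore H (k - H.card) l x + if r ∈ H then 0 else 1 := by
  obtain ⟨k, rfl⟩ := Nat.exists_eq_add_of_le' hk
  by_cases hrx : r = x
  · subst hrx
    by_cases hrl : r ∈ l <;> simp [outsideBefore, lruStep, hrl, hx]
  have hxr : x ≠ r := Ne.symm hrx
  by_cases hrl : r ∈ l
  · have h := (takeWhile_erase_sublist (fun y => decide (y ≠ x)) l (r := r)
      (by simpa using hrx)).countP_le (p := fun y => decide (y ∉ H))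
    by_cases hxl : x ∈ l
    · by_cases hrH : r ∈ H <;>
        simp [outsideBefore, lruStep, hrl, hxl, hrx, hxr, hrH, List.mem_erase_of_ne] at h ⊢ <;>
        exact h
    · simp [outsideBefore, lruStep, hrl, hxl, hrx, hxr, List.mem_erase_of_ne]
  · by_cases hxt : x ∈ l.take k
    · have hxl : x ∈ l := List.mem_of_mem_take hxt
      have h := (takeWhile_take_sublist (fun y => decide (y ≠ x)) l k).countP_le
        (p := fun y => decide (y ∉ H))
      by_cases hrH : r ∈ H <;>
        simp [outsideBefore, lruStep, hrl, hxl, hxt, hrx, hxr, hrH] at h ⊢ <;> exact h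
    -- Here `x` does not survive the truncation; if it was in the cache, this is the eviction.
    · by_cases hxl : x ∈ l
      · have h := le_countP_takeWhile hl hx (k := k + 1) hxl hxt
        simp [outsideBefore, lruStep, hrl, hxl, hxt, hrx, hxr] at h ⊢
        omega
      · simp [outsideBefore, lruStep, hrl, hxl, hxt, hrx, hxr]

/-- Potentials are summed over $H$. A request outside $H$ raises the sum by at most $|H|$ and may
itself be a fault of weight $k-|H|$, in total $k$; a fault inside $H$ is paid by the released
potential. -/
theorem mul_lruCost_le (H : Finset M) {k : ℕ} (hk : 1 ≤ k) (hH : H.card ≤ k) (σ : List M)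
    {l : List M} (hl : l.Nodup) :
    (k - H.card) * lruCost k l σ ≤ ∑ x ∈ H, outsideBefore H (k - H.card) l x +
      k * σ.countP fun r => decide (r ∉ H) := by
  induction σ generalizing l with
  | nil => simp [lruCost]
  | cons r σ ih =>
    have h1 := ih (nodup_lruStep k hl r)
    have h2 := Finset.sum_le_sum fun x (hx : x ∈ H) => outsideBefore_lruStep_le hk hl hx r
    rw [Finset.sum_add_distrib, Finset.sum_add_distrib] at h2
    simp only [lruCost, List.countP_cons, mul_add]
    generalize ∑ x ∈ H, outsideBefore H (k - H.card) l x = Φ at *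
    generalize ∑ x ∈ H, outsideBefore H (k - H.card) (lruStep k l r) x = Φ' at *
    generalize lruCost k (lruStep k l r) σ = c at *
    generalize σ.countP (fun r => decide (r ∉ H)) = N at *
    by_cases hrH : r ∈ H
    · by_cases hrl : r ∈ l
      · simp [hrH, hrl] at h2 ⊢
        omega
      · simp [hrH, hrl] at h2 ⊢
        omega
    · have h3 : (k - H.card) * (if r ∈ l then 0 else 1) ≤ k - H.card := by split_ifs <;> simp
      simp only [hrH, if_false, Finset.sum_const, smul_eq_mul, mul_one] at h2
      simp only [hrH, not_false_eq_true, decide_true, if_true, mul_one]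
      omega

theorem lruCost_le (H : Finset M) {k : ℕ} (hk : 1 ≤ k) (hH : 2 * H.card ≤ k) (σ : List M) :
    lruCost k [] σ ≤ k + 2 * σ.countP fun r => decide (r ∉ H) := by
  have h := mul_lruCost_le H hk (by omega) σ (l := []) List.nodup_nil
  simp only [outsideBefore, List.not_mem_nil, if_false, Finset.sum_const, smul_eq_mul] at h
  have h2 : 0 < k - H.card := by omega
  refine Nat.le_of_mul_le_mul_left (h.trans ?_) h2
  -- The empty cache has potential $|H|(k-|H|)$, which gives the additive term; $2|H|\le k$ gives
  -- $k\le 2(k-|H|)$.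
  rw [mul_add, mul_comm H.card, ← mul_assoc]
  gcongr <;> omega

end lru

/-! ### The cost of `PLFU` -/

theorem plfuCost_le (m k : ℕ) (σ : List (Fin m)) :
    plfuCost m k σ ≤ 2 * σ.countP fun r : Fin m => decide (k ≤ (r : ℕ)) := by
  induction σ with
  | nil => simp [plfuCost]
  | cons r σ ih =>
    rw [plfuCost, List.countP_cons]
    by_cases hr : (r : ℕ) < k
    · have : r ∈ topPages m k := by simp [topPages, hr]
      simp [plfuServe, this, Nat.not_le.2 hr, ih]
    · have hr' : r ∉ topPages m k := by simp [topPages, hr]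
      have h1 : (plfuServe m k r \ topPages m k).card ≤ 1 := by
        refine (Finset.card_le_card (t := {r}) fun x => ?_).trans (by simp)
        rw [plfuServe, if_neg hr']
        simp only [topPages, Finset.mem_sdiff, Finset.mem_insert,
          Finset.mem_filter, Finset.mem_univ, true_and, Finset.mem_singleton]
        rintro ⟨h | h, h'⟩
        · exact h
        · omega
      have h2 : (topPages m k \ plfuServe m k r).card ≤ 1 := by
        refine Finset.card_le_one.2 fun x hx y hy => ?_
        rw [plfuServe, if_neg hr'] at hx hy
        simp only [topPages, Finset.mem_sdiff, Finset.mem_insert,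
          Finset.mem_filter, Finset.mem_univ, true_and, not_or] at hx hy
        apply Fin.ext
        omega
      simp [Nat.not_lt.1 hr]
      omega

theorem card_topPages_le (m k : ℕ) : (topPages m k).card ≤ k := by
  rw [← Finset.card_range k, ← Finset.card_map Fin.valEmbedding]
  refine Finset.card_le_card fun i => ?_
  simp [topPages]
  rintro x hx rfl
  exact hx

end Paging

namespace Paging

open Filter

/-! ### Power-law probabilities -/

theorem powerNorm_pos (α : ℝ) {m : ℕ} (hm : 1 ≤ m) : 0 < powerNorm α m := by
  refine Finset.sum_pos (fun i hi => ?_) ⟨1, by simpa⟩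
  have : 0 < (i : ℝ) := by exact_mod_cast (Finset.mem_Icc.1 hi).1
  positivity

theorem powerNorm_nonneg (α : ℝ) (m : ℕ) : 0 ≤ powerNorm α m :=
  Finset.sum_nonneg fun i _ => by positivity

theorem powerProb_nonneg (α : ℝ) (m i : ℕ) : 0 ≤ powerProb α m i := by
  have := powerNorm_nonneg α m
  unfold powerProb
  positivity

theorem powerProb_pos (α : ℝ) {m i : ℕ} (hm : 1 ≤ m) (hi : 1 ≤ i) : 0 < powerProb α m i := by
  have := powerNorm_pos α hm
  have : 0 < (i : ℝ) := by exact_mod_cast hi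
  unfold powerProb
  positivity

theorem powerProb_le_mul {α : ℝ} (hα : 0 ≤ α) (m : ℕ) {a b : ℕ} {c : ℝ} (ha : 1 ≤ a) (hb : 1 ≤ b)
    (hc : 0 ≤ c) (h : (b : ℝ) ≤ c * a) : powerProb α m a ≤ c ^ α * powerProb α m b := by
  have h0 := powerNorm_nonneg α m
  have ha' : 0 < (a : ℝ) := by exact_mod_cast ha
  have hb' : 0 < (b : ℝ) := by exact_mod_cast hb
  unfold powerProb
  rw [mul_left_comm]
  refine mul_le_mul_of_nonneg_left ?_ (by positivity)
  rw [mul_one_div, div_le_div_iff₀ (by positivity) (by positivity), one_mul,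
    ← Real.mul_rpow hc ha'.le]
  exact Real.rpow_le_rpow hb'.le h hα

theorem powerProb_anti {α : ℝ} (hα : 0 ≤ α) (m : ℕ) {a b : ℕ} (hb : 1 ≤ b) (h : b ≤ a) :
    powerProb α m a ≤ powerProb α m b := by
  have := powerProb_le_mul hα m (hb.trans h) hb zero_le_one (by rw [one_mul]; exact_mod_cast h)
  rwa [Real.one_rpow, one_mul] at this

theorem sum_powerLaw_filter (α : ℝ) (m k : ℕ) :
    ∑ j ∈ Finset.univ.filter (fun j : Fin m => k ≤ (j : ℕ)), powerLaw α m j =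
      ∑ i ∈ Finset.Ico k m, powerProb α m (i + 1) := by
  rw [Finset.sum_filter]
  unfold powerLaw
  rw [Fin.sum_univ_eq_sum_range (fun i => if k ≤ i then powerProb α m (i + 1) else 0) m,
    ← Finset.sum_filter]
  congr 1
  ext i
  simp
  omega

theorem sum_powerLaw (α : ℝ) {m : ℕ} (hm : 1 ≤ m) : ∑ j, powerLaw α m j = 1 := by
  have h := sum_powerLaw_filter α m 0
  simp only [Nat.zero_le, Finset.filter_true] at h
  rw [h, Finset.sum_Ico_add' (fun i => powerProb α m i) 0 m 1]
  unfold powerProb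
  rw [← Finset.mul_sum, one_div, zero_add]
  exact inv_mul_cancel₀ (powerNorm_pos α hm).ne'

/-- The probability of requesting a page that is not among the `k` most popular ones. -/
noncomputable def tailProb (α : ℝ) (m k : ℕ) : ℝ := ∑ i ∈ Finset.Ico k m, powerProb α m (i + 1)

theorem tailProb_pos (α : ℝ) {m k : ℕ} (hk : k < m) : 0 < tailProb α m k :=
  Finset.sum_pos (fun i _ => powerProb_pos α (by omega) (by omega)) (by simpa)

theorem tailProb_le_one (α : ℝ) {m : ℕ} (hm : 1 ≤ m) (k : ℕ) : tailProb α m k ≤ 1 := by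
  rw [← sum_powerLaw α hm, tailProb, ← sum_powerLaw_filter]
  exact Finset.sum_le_sum_of_subset_of_nonneg (Finset.filter_subset _ _)
    fun j _ _ => powerProb_nonneg _ _ _

/-- Each page between $k/2$ and $k$ is at most $4^\alpha$ times as likely as page $2k$, and the tail
contains $k$ pages at least as likely as page $2k$. -/
theorem tailProb_half_le {α : ℝ} (hα : 0 ≤ α) {m k : ℕ} (hk : 1 ≤ k) (hm : 2 * k ≤ m) :
    tailProb α m (k / 2) ≤ (1 + 4 ^ α) * tailProb α m k := by
  have h1 : ∑ i ∈ Finset.Ico (k / 2) k, powerProb α m (i + 1) ≤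
      k * (4 ^ α * powerProb α m (2 * k)) := by
    have h : ∀ i ∈ Finset.Ico (k / 2) k, powerProb α m (i + 1) ≤
        4 ^ α * powerProb α m (2 * k) := fun i hi => by
      refine powerProb_le_mul hα m (by omega) (by omega) (by norm_num) ?_
      have := (Finset.mem_Ico.1 hi).1
      have : 2 * k ≤ 4 * (i + 1) := by omega
      exact_mod_cast this
    refine (Finset.sum_le_card_nsmul _ _ _ h).trans ?_
    rw [nsmul_eq_mul, Nat.card_Ico]
    have := powerProb_nonneg α m (2 * k)
    gcongr
    omega
  have h2 : k * powerProb α m (2 * k) ≤ tailProb α m k := by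
    calc k * powerProb α m (2 * k) = ∑ i ∈ Finset.Ico k (2 * k), powerProb α m (2 * k) := by
          rw [Finset.sum_const, Nat.card_Ico, nsmul_eq_mul, show 2 * k - k = k by omega]
      _ ≤ ∑ i ∈ Finset.Ico k (2 * k), powerProb α m (i + 1) :=
          Finset.sum_le_sum fun i hi => powerProb_anti hα m (by omega) (Finset.mem_Ico.1 hi).2
      _ ≤ _ := Finset.sum_le_sum_of_subset_of_nonneg (Finset.Ico_subset_Ico_right hm)
          fun _ _ _ => powerProb_nonneg _ _ _
  have h3 : tailProb α m (k / 2) =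
      ∑ i ∈ Finset.Ico (k / 2) k, powerProb α m (i + 1) + tailProb α m k :=
    (Finset.sum_Ico_consecutive _ (by omega) (by omega)).symm
  have h4 := mul_le_mul_of_nonneg_left h2 (show (0 : ℝ) ≤ 4 ^ α by positivity)
  linarith

/-! ### The number of distinct pages in a window of requests -/

/-- If page $2k$ is expected at least twice, each of the first $2k$ pages occurs with probability at
least $1-e^{-2}\ge 3/4$. Otherwise each page beyond $k$ has expected count $x\le X=2^{\alpha+1}$, so
it occurs with probability at least $1-e^{-x}\ge x/(1+X)$, and these sum to at least $Nq/(1+X)$. -/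
theorem le_sum_one_sub_pow {α : ℝ} (hα : 0 ≤ α) {m k N : ℕ} (hk : 1 ≤ k) (hm : 2 * k ≤ m)
    (hN : 3 / 2 * (1 + 2 ^ (α + 1)) * k ≤ N * tailProb α m k) :
    3 / 2 * (k : ℝ) ≤ ∑ j, (1 - (1 - powerLaw α m j) ^ N) := by
  have hle : ∀ i < m, powerProb α m (i + 1) ≤ 1 := fun i hi => by
    rw [← sum_powerLaw α (show 1 ≤ m by omega)]
    exact Finset.single_le_sum (f := powerLaw α m) (fun j _ => powerProb_nonneg _ _ _)
      (Finset.mem_univ (⟨i, hi⟩ : Fin m))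
  have hexp : ∀ i < m, 1 - Real.exp (-(N * powerProb α m (i + 1))) ≤
      1 - (1 - powerProb α m (i + 1)) ^ N := fun i hi => by
    have h := pow_le_pow_left₀ (by linarith [hle i hi])
      (Real.one_sub_le_exp_neg (powerProb α m (i + 1))) N
    rw [← Real.exp_nat_mul, mul_neg] at h
    linarith
  have h0 : ∀ i < m, 0 ≤ 1 - (1 - powerProb α m (i + 1)) ^ N := fun i hi => by
    have := pow_le_one₀ (n := N) (by linarith [hle i hi])
      (show 1 - powerProb α m (i + 1) ≤ 1 by linarith [powerProb_nonneg α m (i + 1)])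
    linarith
  unfold powerLaw
  rw [Fin.sum_univ_eq_sum_range (fun i => 1 - (1 - powerProb α m (i + 1)) ^ N) m]
  by_cases hc : 2 ≤ N * powerProb α m (2 * k)
  · have h4 : Real.exp (-2) ≤ 1 / 4 := by
      have h := Real.add_one_le_exp (1 : ℝ)
      have h2 : Real.exp 2 = Real.exp 1 * Real.exp 1 := by rw [← Real.exp_add]; norm_num
      rw [Real.exp_neg, ← one_div]
      exact one_div_le_one_div_of_le (by norm_num) (by nlinarith)
    calc 3 / 2 * (k : ℝ) = ∑ i ∈ Finset.range (2 * k), (3 / 4 : ℝ) := by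
          rw [Finset.sum_const, Finset.card_range, nsmul_eq_mul]
          push_cast
          ring
      _ ≤ ∑ i ∈ Finset.range (2 * k), (1 - (1 - powerProb α m (i + 1)) ^ N) := by
          refine Finset.sum_le_sum fun i hi => ?_
          have hi := Finset.mem_range.1 hi
          refine le_trans ?_ (hexp i (by omega))
          have h5 : (N : ℝ) * powerProb α m (2 * k) ≤ N * powerProb α m (i + 1) :=
            mul_le_mul_of_nonneg_left (powerProb_anti hα m (by omega) hi) (Nat.cast_nonneg _)
          have := Real.exp_le_exp.2 (show -(N * powerProb α m (i + 1)) ≤ -2 by linarith)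
          linarith
      _ ≤ _ := Finset.sum_le_sum_of_subset_of_nonneg (Finset.range_subset_range.2 hm)
          fun i hi _ => h0 i (Finset.mem_range.1 hi)
  · push Not at hc
    set X : ℝ := 2 ^ (α + 1) with hX
    have hX0 : 0 < X := by positivity
    have hsmall : ∀ i, k ≤ i → N * powerProb α m (i + 1) ≤ X := fun i hi => by
      have h1 : powerProb α m (i + 1) ≤ 2 ^ α * powerProb α m (2 * k) := by
        refine powerProb_le_mul hα m (by omega) (by omega) (by norm_num) ?_
        have : 2 * k ≤ 2 * (i + 1) := by omega
        exact_mod_cast this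
      have h2 := mul_le_mul_of_nonneg_left h1 (Nat.cast_nonneg (α := ℝ) N)
      have h3 := mul_le_mul_of_nonneg_left hc.le (show (0 : ℝ) ≤ 2 ^ α by positivity)
      rw [hX, Real.rpow_add_one (by norm_num)]
      linarith
    calc 3 / 2 * (k : ℝ) ≤ (N * tailProb α m k) / (1 + X) := by
          rw [le_div_iff₀ (by positivity)]
          linarith
      _ = ∑ i ∈ Finset.Ico k m, (N * powerProb α m (i + 1)) / (1 + X) := by
          rw [tailProb, Finset.mul_sum, Finset.sum_div]
      _ ≤ ∑ i ∈ Finset.Ico k m, (1 - (1 - powerProb α m (i + 1)) ^ N) := by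
          refine Finset.sum_le_sum fun i hi => ?_
          rw [Finset.mem_Ico] at hi
          refine le_trans ?_ (hexp i hi.2)
          have hx0 : 0 ≤ N * powerProb α m (i + 1) :=
            mul_nonneg (Nat.cast_nonneg _) (powerProb_nonneg _ _ _)
          have hxX := hsmall i hi.1
          generalize (N : ℝ) * powerProb α m (i + 1) = x at *
          have h1 : Real.exp (-x) ≤ 1 / (1 + x) := by
            rw [Real.exp_neg, ← one_div]
            exact one_div_le_one_div_of_le (by linarith) (by linarith [Real.add_one_le_exp x])
          have h2 : x / (1 + X) ≤ x / (1 + x) := by gcongr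
          have h3 : x / (1 + x) = 1 - 1 / (1 + x) := by field_simp; ring
          linarith
      _ ≤ _ := by
          refine Finset.sum_le_sum_of_subset_of_nonneg (fun i hi => ?_)
            fun i hi _ => h0 i (Finset.mem_range.1 hi)
          exact Finset.mem_range.2 (Finset.mem_Ico.1 hi).2

/-! ### Ratios of expectations -/

theorem le_expCost_optCost {α : ℝ} (hα : 0 ≤ α) {m k : ℕ} (hk : 1 ≤ k) (hm : 2 * k ≤ m)
    {C : Finset (Fin m)} (hC : C.card ≤ k) {A : ℝ} (hA : A = 3 / 2 * (1 + 2 ^ (α + 1))) {n : ℕ}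
    (hn : (A + 1) * k / tailProb α m k ≤ n) :
    n * tailProb α m k / (4 * (A + 1)) ≤ expCost (powerLaw α m) n (optCost k C) := by
  have hq := tailProb_pos α (show k < m by omega)
  have hq1 := tailProb_le_one α (show 1 ≤ m by omega) k
  set q := tailProb α m k with hqdef
  have hk' : (1 : ℝ) ≤ k := by exact_mod_cast hk
  have hA0 : 0 < A := by rw [hA]; positivity
  obtain ⟨N, hN⟩ : ∃ N, N = ⌈A * k / q⌉₊ := ⟨_, rfl⟩
  have hN1 : A * k / q ≤ N := hN ▸ Nat.le_ceil _
  -- Rounding up adds less than 1, which is at most $k/q$.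
  have hN2 : (N : ℝ) ≤ (A + 1) * k / q := by
    have h1 : (N : ℝ) < A * k / q + 1 := hN ▸ Nat.ceil_lt_add_one (by positivity)
    have h2 : 1 ≤ k / q := by rw [le_div_iff₀ hq]; linarith
    have h3 : (A + 1) * k / q = A * k / q + k / q := by ring
    linarith
  have hN0 : 0 < (N : ℝ) := lt_of_lt_of_le (by positivity) hN1
  have hD := le_sum_one_sub_pow (N := N) hα hk hm (by rw [← hA]; rwa [div_le_iff₀ hq] at hN1)
  have hopt := le_listExp_freeOptCost (π := powerLaw α m) (fun _ => powerProb_nonneg _ _ _)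
    (sum_powerLaw α (by omega)) hk N (n / N) (n % N)
  rw [Nat.div_add_mod'] at hopt
  have hmono := listExp_mono (π := powerLaw α m) (fun _ => powerProb_nonneg _ _ _) n
    fun σ => (Nat.cast_le (α := ℝ)).2 (freeOptCost_le_optCost hk hC σ)
  rw [expCost_eq_listExp]
  refine le_trans ?_ (hopt.trans hmono)
  have hNn : N ≤ n := by exact_mod_cast hN2.trans hn
  have hN0' : 0 < N := by exact_mod_cast hN0
  -- At least one full window fits, so dropping the incomplete one loses at most a factor 2.
  have hw : n ≤ 2 * (n / N) * N := by
    have h1 := Nat.div_add_mod' n N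
    have h2 := Nat.mod_lt n hN0'
    have h3 : 1 * N ≤ n / N * N := Nat.mul_le_mul_right _ (Nat.div_pos hNn hN0')
    nlinarith
  have hw' : (n : ℝ) ≤ 2 * ((n / N : ℕ) : ℝ) * N := by exact_mod_cast hw
  set w : ℝ := ((n / N : ℕ) : ℝ)
  have hw0 : 0 ≤ w := Nat.cast_nonneg _
  have h5 : N * q ≤ (A + 1) * k := by rwa [le_div_iff₀ hq] at hN2
  calc n * q / (4 * (A + 1)) ≤ 2 * w * N * q / (4 * (A + 1)) := by gcongr
    _ = w * (N * q) / (2 * (A + 1)) := by field_simp; ring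
    _ ≤ w * ((A + 1) * k) / (2 * (A + 1)) := by gcongr
    _ = w * (k / 2) := by field_simp
    _ ≤ _ := mul_le_mul_of_nonneg_left (by linarith) hw0

theorem ratioOfExpectations_le {m : ℕ} {π : Fin m → ℝ} {alg opt : List (Fin m) → ℕ} {q K D : ℝ}
    (hq : 0 < q) (hK : 0 ≤ K) (hD : 0 < D) (n₀ : ℕ)
    (h₁ : ∀ n, n₀ ≤ n → expCost π n alg ≤ K * (n * q))
    (h₂ : ∀ n, n₀ ≤ n → n * q / D ≤ expCost π n opt) :
    ratioOfExpectations π alg opt ≤ ENNReal.ofReal (K * D) := by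
  refine limsup_le_of_le (by isBoundedDefault) (eventually_atTop.2 ⟨n₀ + 1, fun n hn => ?_⟩)
  have h1 := h₁ n (by omega)
  have h2 := h₂ n (by omega)
  have hn' : 0 < (n : ℝ) := by exact_mod_cast (by omega : 0 < n)
  have hpos : 0 < expCost π n opt := lt_of_lt_of_le (by positivity) h2
  rw [← ENNReal.ofReal_div_of_pos hpos]
  refine ENNReal.ofReal_le_ofReal ?_
  rw [div_le_iff₀ hpos]
  rw [div_le_iff₀ hD] at h2
  calc _ ≤ _ := h1
    _ ≤ K * (expCost π n opt * D) := by gcongr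
    _ = _ := by ring

theorem roeLRU_le {α : ℝ} (hα : 0 ≤ α) {m k : ℕ} (hk : 1 ≤ k) (hm : 2 * k ≤ m) {A : ℝ}
    (hA : A = 3 / 2 * (1 + 2 ^ (α + 1))) :
    roeLRU (powerLaw α m) k ≤ ENNReal.ofReal ((3 + 2 * 4 ^ α) * (4 * (A + 1))) := by
  have hq := tailProb_pos α (show k < m by omega)
  have hk' : (1 : ℝ) ≤ k := by exact_mod_cast hk
  have hA0 : 0 < A := by rw [hA]; positivity
  refine ratioOfExpectations_le hq (by positivity) (by positivity)
    ⌈(A + 1) * k / tailProb α m k⌉₊ (fun n hn => ?_)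
    fun n hn => le_expCost_optCost hα hk hm (by simp) hA (Nat.ceil_le.1 hn)
  have hn := Nat.ceil_le.1 hn
  have hcost : ∀ σ : List (Fin m), (lruCost k [] σ : ℝ) ≤
      k + 2 * (σ.countP fun r : Fin m => decide (k / 2 ≤ (r : ℕ)) : ℕ) := fun σ => by
    have h := lruCost_le (topPages m (k / 2)) hk
      (by have := card_topPages_le m (k / 2); omega) σ
    simp only [topPages, Finset.mem_filter, Finset.mem_univ, true_and, not_lt] at h
    exact_mod_cast h
  have h := listExp_mono (π := powerLaw α m) (fun _ => powerProb_nonneg _ _ _) n hcost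
  have h1 := sum_powerLaw α (show 1 ≤ m by omega)
  rw [← expCost_eq_listExp, listExp_add, listExp_const h1, listExp_const_mul,
    listExp_countP h1 n fun r : Fin m => k / 2 ≤ (r : ℕ), sum_powerLaw_filter] at h
  have h2 := mul_le_mul_of_nonneg_left (tailProb_half_le hα hk hm) (Nat.cast_nonneg (α := ℝ) n)
  rw [div_le_iff₀ hq] at hn
  -- The additive $k$ of the cold start is absorbed, since $(A+1)k\le nq$ for these $n$.
  have h3 : (k : ℝ) ≤ (A + 1) * k := by nlinarith
  unfold tailProb at *
  linarith

theorem roePLFU_le {α : ℝ} (hα : 0 ≤ α) {m k : ℕ} (hk : 1 ≤ k) (hm : 2 * k ≤ m) {A : ℝ}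
    (hA : A = 3 / 2 * (1 + 2 ^ (α + 1))) :
    roePLFU (powerLaw α m) k ≤ ENNReal.ofReal (2 * (4 * (A + 1))) := by
  have hq := tailProb_pos α (show k < m by omega)
  have hA0 : 0 < A := by rw [hA]; positivity
  refine ratioOfExpectations_le hq (by positivity) (by positivity)
    ⌈(A + 1) * k / tailProb α m k⌉₊ (fun n hn => ?_)
    fun n hn => le_expCost_optCost hα hk hm (card_topPages_le m k) hA (Nat.ceil_le.1 hn)
  have hcost : ∀ σ : List (Fin m), (plfuCost m k σ : ℝ) ≤
      2 * (σ.countP fun r : Fin m => decide (k ≤ (r : ℕ)) : ℕ) := fun σ => by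
    exact_mod_cast plfuCost_le m k σ
  have h := listExp_mono (π := powerLaw α m) (fun _ => powerProb_nonneg _ _ _) n hcost
  have h1 := sum_powerLaw α (show 1 ≤ m by omega)
  rwa [← expCost_eq_listExp, listExp_const_mul, listExp_countP h1 n fun r : Fin m => k ≤ (r : ℕ),
    sum_powerLaw_filter] at h

end Paging

namespace Paging

/-! ### Sums and integrals of powers -/

/-- The integral of `x ^ (-α)` from `a` to `b`. -/
noncomputable def powInt (α a b : ℝ) : ℝ := ∫ x in a..b, x ^ (-α)

theorem intervalIntegrable_powInt (α : ℝ) {a b : ℝ} (ha : 0 < a) (hb : 0 < b) :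
    IntervalIntegrable (fun x : ℝ => x ^ (-α)) MeasureTheory.volume a b :=
  intervalIntegral.intervalIntegrable_rpow (Or.inr (Set.notMem_uIcc_of_lt ha hb))

theorem powInt_add (α : ℝ) {a b c : ℝ} (ha : 0 < a) (hb : 0 < b) (hc : 0 < c) :
    powInt α a b + powInt α b c = powInt α a c :=
  intervalIntegral.integral_add_adjacent_intervals (intervalIntegrable_powInt α ha hb)
    (intervalIntegrable_powInt α hb hc)

theorem powInt_pos (α : ℝ) {a b : ℝ} (ha : 0 < a) (hab : a < b) : 0 < powInt α a b :=
  intervalIntegral.intervalIntegral_pos_of_pos_on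
    (intervalIntegrable_powInt α ha (ha.trans hab))
    (fun _ hx => Real.rpow_pos_of_pos (ha.trans hx.1) _) hab

theorem powInt_nonneg (α : ℝ) {a b : ℝ} (ha : 0 < a) (hab : a ≤ b) : 0 ≤ powInt α a b := by
  rcases hab.eq_or_lt with rfl | h
  · simp [powInt]
  · exact (powInt_pos α ha h).le

theorem powInt_mono (α : ℝ) {a b c d : ℝ} (hc : 0 < c) (hca : c ≤ a) (hab : a ≤ b) (hbd : b ≤ d) :
    powInt α a b ≤ powInt α c d := by
  have ha := hc.trans_le hca
  have hb := ha.trans_le hab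
  have h1 := powInt_add α hc ha hb
  have h2 := powInt_add α hc hb (hb.trans_le hbd)
  linarith [powInt_nonneg α hc hca, powInt_nonneg α hb hbd]

theorem powInt_mul (α : ℝ) {a b c : ℝ} (hc : 0 < c) (ha : 0 < a) (hab : a ≤ b) :
    powInt α (c * a) (c * b) = c ^ (1 - α) * powInt α a b := by
  have h : ∫ x in a..b, (c * x) ^ (-α) = ∫ x in a..b, c ^ (-α) * x ^ (-α) := by
    refine intervalIntegral.integral_congr fun x hx => ?_
    rw [Set.uIcc_of_le hab] at hx
    exact Real.mul_rpow hc.le (ha.le.trans hx.1)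
  have h' := intervalIntegral.mul_integral_comp_mul_left (a := a) (b := b)
    (f := fun x : ℝ => x ^ (-α)) c
  rw [powInt, ← h', h, intervalIntegral.integral_const_mul, ← mul_assoc, powInt, sub_eq_add_neg, Real.rpow_add hc,
    Real.rpow_one]

theorem powInt_eq {α a b : ℝ} (hα : α ≠ 1) (ha : 0 < a) (hb : 0 < b) :
    powInt α a b = (b ^ (1 - α) - a ^ (1 - α)) / (1 - α) := by
  rw [powInt, integral_rpow (Or.inr ⟨fun h => hα (by linarith), Set.notMem_uIcc_of_lt ha hb⟩),
    neg_add_eq_sub]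

theorem powInt_one {a b : ℝ} (ha : 0 < a) (hb : 0 < b) : powInt 1 a b = Real.log (b / a) := by
  rw [← integral_inv_of_pos ha hb, powInt]
  simp_rw [Real.rpow_neg_one]

theorem antitoneOn_rpow_neg {α : ℝ} (hα : 0 ≤ α) :
    AntitoneOn (fun x : ℝ => x ^ (-α)) (Set.Ioi 0) := fun _ hx _ _ hxy =>
  Real.rpow_le_rpow_of_nonpos hx hxy (neg_nonpos.2 hα)

theorem powInt_le_sum {α : ℝ} (hα : 0 ≤ α) {a b : ℕ} (ha : 1 ≤ a) (hab : a ≤ b) :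
    powInt α a b ≤ ∑ i ∈ Finset.Ico a b, (i : ℝ) ^ (-α) :=
  AntitoneOn.integral_le_sum_Ico hab ((antitoneOn_rpow_neg hα).mono fun _ hx =>
    lt_of_lt_of_le (by exact_mod_cast ha) hx.1)

theorem sum_le_powInt {α : ℝ} (hα : 0 ≤ α) {a b : ℕ} (ha : 1 ≤ a) (hab : a ≤ b) :
    ∑ i ∈ Finset.Ico (a + 1) (b + 1), (i : ℝ) ^ (-α) ≤ powInt α a b := by
  rw [← Finset.sum_Ico_add' (fun i : ℕ => (i : ℝ) ^ (-α))]
  exact AntitoneOn.sum_le_integral_Ico hab ((antitoneOn_rpow_neg hα).mono fun _ hx =>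
    lt_of_lt_of_le (by exact_mod_cast ha) hx.1)

/-- Midpoint inequality: the convex function lies above its tangent at `y`, whose integral over the
unit interval centred at `y` is the value at `y`. -/
theorem rpow_neg_le_powInt {α : ℝ} (hα : 0 ≤ α) {y : ℝ} (hy : 1 ≤ y) :
    y ^ (-α) ≤ powInt α (y - 1 / 2) (y + 1 / 2) := by
  have hy0 : 0 < y := by linarith
  have h : ∫ x in (y - 1 / 2)..(y + 1 / 2), (y ^ (-α) * (1 + α) - y ^ (-α) * α / y * x) ≤
      powInt α (y - 1 / 2) (y + 1 / 2) := by
    refine intervalIntegral.integral_mono_on (by linarith)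
      (Continuous.intervalIntegrable (by fun_prop) _ _)
      (intervalIntegrable_powInt α (by linarith) (by linarith)) fun x hx => ?_
    have hx0 : 0 < x := by linarith [hx.1]
    have h1 : x ^ (-α) = y ^ (-α) * (x / y) ^ (-α) := by
      rw [← Real.mul_rpow hy0.le (by positivity), mul_div_cancel₀ _ hy0.ne']
    have h2 : 1 + α - α * (x / y) ≤ (x / y) ^ (-α) := by
      rw [Real.rpow_def_of_pos (by positivity)]
      have h3 := Real.add_one_le_exp (Real.log (x / y) * -α)
      have h4 := mul_le_mul_of_nonneg_left (Real.log_le_sub_one_of_pos (x := x / y) (by positivity)) hα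
      linarith
    have h5 := mul_le_mul_of_nonneg_left h2 (Real.rpow_pos_of_pos hy0 (-α)).le
    rw [h1]
    refine le_trans (le_of_eq ?_) h5
    ring
  refine le_trans (le_of_eq ?_) h
  rw [intervalIntegral.integral_sub (Continuous.intervalIntegrable (by fun_prop) _ _)
    (Continuous.intervalIntegrable (by fun_prop) _ _), intervalIntegral.integral_const_mul,
    intervalIntegral.integral_const_mul, integral_id, intervalIntegral.integral_const]
  simp only [smul_eq_mul]
  field_simp
  ring

theorem sum_le_powInt_sub_half {α : ℝ} (hα : 0 ≤ α) {a b : ℕ} (ha : 1 ≤ a) (hab : a ≤ b) :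
    ∑ i ∈ Finset.Ico a b, (i : ℝ) ^ (-α) ≤ powInt α (a - 1 / 2) (b - 1 / 2) := by
  have ha' : (1 : ℝ) ≤ a := by exact_mod_cast ha
  induction b, hab using Nat.le_induction with
  | base => simp [powInt]
  | succ b hab ih =>
    have hb' : (a : ℝ) ≤ b := by exact_mod_cast hab
    rw [Finset.sum_Ico_succ_top hab]
    have h1 := rpow_neg_le_powInt hα (y := b) (by linarith)
    have h2 := powInt_add α (a := a - 1 / 2) (b := b - 1 / 2) (c := b + 1 / 2) (by linarith)
      (by linarith) (by linarith)
    rw [show ((b + 1 : ℕ) : ℝ) - 1 / 2 = b + 1 / 2 by push_cast; ring]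
    linarith

theorem sum_rpow_pos (α : ℝ) {a b : ℕ} (ha : 1 ≤ a) (hab : a < b) :
    0 < ∑ i ∈ Finset.Ico a b, (i : ℝ) ^ (-α) :=
  Finset.sum_pos (fun i hi => Real.rpow_pos_of_pos
    (by exact_mod_cast ha.trans (Finset.mem_Ico.1 hi).1) _) (by simpa)

theorem sum_rpow_mono (α : ℝ) {a b c d : ℕ} (hca : c ≤ a) (hbd : b ≤ d) :
    ∑ i ∈ Finset.Ico a b, (i : ℝ) ^ (-α) ≤ ∑ i ∈ Finset.Ico c d, (i : ℝ) ^ (-α) :=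
  Finset.sum_le_sum_of_subset_of_nonneg (Finset.Ico_subset_Ico hca hbd)
    fun i _ _ => Real.rpow_nonneg (Nat.cast_nonneg i) _

/-! ### Comparison of the middle segment with the tail -/

theorem powInt_shift_le {α : ℝ} (hα : 0 ≤ α) {a b s : ℝ} (ha : 0 < a) (hab : a ≤ b) (hs : 0 ≤ s) :
    powInt α (a + s) (b + s) ≤ powInt α a b := by
  rw [powInt, ← intervalIntegral.integral_comp_add_right (fun x => x ^ (-α)), powInt]
  have h0 : 0 < a + s := by linarith
  refine intervalIntegral.integral_mono_on hab ?_
    (intervalIntegrable_powInt α ha (by linarith)) fun x hx => ?_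
  · have := (intervalIntegrable_powInt α (a := a + s) (b := b + s) h0 (by linarith)).comp_add_right s
    simpa using this
  · exact antitoneOn_rpow_neg hα (ha.trans_le hx.1) (show 0 < x + s by linarith [hx.1]) (by linarith)

theorem powInt_eq_sum (α : ℝ) {a b : ℕ} (ha : 1 ≤ a) (hab : a ≤ b) :
    powInt α a b = ∑ n ∈ Finset.Ico a b, powInt α n (n + 1) := by
  have ha' : (1 : ℝ) ≤ a := by exact_mod_cast ha
  induction b, hab using Nat.le_induction with
  | base => simp [powInt]
  | succ b hab ih =>
    have hb' : (a : ℝ) ≤ b := by exact_mod_cast hab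
    rw [Finset.sum_Ico_succ_top hab, ← ih, powInt_add α (by linarith) (by linarith) (by linarith)]
    push_cast
    rfl

theorem powInt_mul_rpow_neg (α : ℝ) {a b i : ℕ} (ha : 1 ≤ a) (hab : a ≤ b) (hi : 1 ≤ i) :
    powInt α a b * (i : ℝ) ^ (-α) =
      1 / i * ∑ n ∈ Finset.Ico (i * a) (i * b), powInt α n (n + 1) := by
  have hi' : 0 < (i : ℝ) := by exact_mod_cast hi
  rw [← powInt_eq_sum α (Nat.mul_pos hi ha) (Nat.mul_le_mul_left _ hab), Nat.cast_mul, Nat.cast_mul,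
    powInt_mul α hi' (by exact_mod_cast ha) (by exact_mod_cast hab), sub_eq_add_neg,
    Real.rpow_add hi', Real.rpow_one]
  field_simp

/-- The case $j=1$ with the tail cut at 16. By scaling, each product of an integral and
$i^{-\alpha}$ is $1/i$ times a sum of unit integrals $D_n$, so both sides become linear in the $D_n$
with explicit rational coefficients. -/
theorem mul_sum_le_mul_sum_one {α : ℝ} (hα : 0 ≤ α) :
    powInt α 3 4 * ∑ i ∈ Finset.Ico (4 : ℕ) 11, (i : ℝ) ^ (-α) ≤
      powInt α 1 3 * ∑ i ∈ Finset.Ico (11 : ℕ) 17, (i : ℝ) ^ (-α) := by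
  have h1 : powInt α 3 4 * ∑ i ∈ Finset.Ico (4 : ℕ) 11, (i : ℝ) ^ (-α) =
      ∑ i ∈ Finset.Ico (4 : ℕ) 11, 1 / (i : ℝ) * ∑ n ∈ Finset.Ico (i * 3) (i * 4), powInt α n (n + 1) := by
    rw [Finset.mul_sum]
    refine Finset.sum_congr rfl fun i hi => ?_
    have := powInt_mul_rpow_neg α (a := 3) (b := 4) (i := i) (by norm_num) (by norm_num)
      (by rw [Finset.mem_Ico] at hi; omega)
    simpa using this
  have h2 : powInt α 1 3 * ∑ i ∈ Finset.Ico (11 : ℕ) 17, (i : ℝ) ^ (-α) =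
      ∑ i ∈ Finset.Ico (11 : ℕ) 17, 1 / (i : ℝ) * ∑ n ∈ Finset.Ico (i * 1) (i * 3), powInt α n (n + 1) := by
    rw [Finset.mul_sum]
    refine Finset.sum_congr rfl fun i hi => ?_
    have := powInt_mul_rpow_neg α (a := 1) (b := 3) (i := i) (by norm_num) (by norm_num)
      (by rw [Finset.mem_Ico] at hi; omega)
    simpa using this
  have hD : ∀ n : ℕ, 0 ≤ powInt α n (n + 1) := fun n =>
    intervalIntegral.integral_nonneg (by linarith) fun x hx =>
      Real.rpow_nonneg ((Nat.cast_nonneg n).trans hx.1) _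
  have h12 : powInt α (12 : ℕ) ((12 : ℕ) + 1) ≤ powInt α (11 : ℕ) ((11 : ℕ) + 1) := by
    have := powInt_shift_le hα (a := 11) (b := 12) (s := 1) (by norm_num) (by norm_num) (by norm_num)
    norm_num at this ⊢
    exact this
  have h15 : powInt α (15 : ℕ) ((15 : ℕ) + 1) ≤ powInt α (14 : ℕ) ((14 : ℕ) + 1) := by
    have := powInt_shift_le hα (a := 14) (b := 15) (s := 1) (by norm_num) (by norm_num) (by norm_num)
    norm_num at this ⊢
    exact this
  rw [h1, h2]
  generalize hDdef : (fun n : ℕ => powInt α (n : ℝ) (n + 1)) = D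
  have hD' : ∀ n : ℕ, powInt α (n : ℝ) (n + 1) = D n := fun n => congrFun hDdef n
  simp only [hD'] at *
  simp only [Finset.sum_Ico_eq_sum_range, Finset.sum_range_succ, Finset.sum_range_zero,
    Nat.reduceMul, Nat.reduceAdd, Nat.reduceSub]
  push_cast
  -- The coefficient on the right is too small only at $n=12$ and $n=15$; the surplus at 11 and 14
  -- covers this, as $D_{12}\le D_{11}$ and $D_{15}\le D_{14}$.
  linarith [
    hD 12, hD 13, hD 14, hD 15, hD 16, hD 17, hD 18, hD 19, hD 20, hD 21, hD 22, hD 23, hD 24, hD 25,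
    hD 26, hD 27, hD 28, hD 29, hD 30, hD 31, hD 32, hD 33, hD 34, hD 35, hD 36, hD 37, hD 38,
    hD 39, hD 40, hD 41, hD 42, hD 43, hD 44, hD 45, hD 46, hD 47]

end Paging

namespace Paging

/-! ### A uniform lower bound -/

theorem segSum_pos (α : ℝ) {m : ℕ} {x : ℝ} (hx : 0 < x) (hxm : x ≤ m) :
    0 < segSum (powerProb α m) x m := by
  have hm : 1 ≤ m := by
    have : 0 < (m : ℝ) := hx.trans_le hxm
    exact_mod_cast this
  refine Finset.sum_pos (fun i hi => powerProb_pos α hm ?_) ⟨m, by simpa using hxm⟩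
  exact (Nat.ceil_pos.2 hx).trans_le (Finset.mem_Icc.1 hi).1

theorem segSum_anti (α : ℝ) (m : ℕ) {x y z : ℝ} (hxy : x ≤ y) :
    segSum (powerProb α m) y z ≤ segSum (powerProb α m) x z :=
  Finset.sum_le_sum_of_subset_of_nonneg (Finset.Icc_subset_Icc_left (Nat.ceil_mono hxy))
    fun _ _ _ => powerProb_nonneg _ _ _

/-- Indices from $3k/8$ up to $3k/2$ are at least $2k/(16/3)$, and at least $k/2$ integers lie in
$[3k/2,2k]$. -/
theorem segSum_le_mul {α : ℝ} (hα : 0 ≤ α) {k m : ℕ} (hk : 1 ≤ k) (hm : 2 * k ≤ m) :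
    segSum (powerProb α m) (3 * k / 8) m ≤
      (1 + 4 * (16 / 3) ^ α) * segSum (powerProb α m) (3 * k / 2) m := by
  have hk' : (1 : ℝ) ≤ k := by exact_mod_cast hk
  have ha1 : 1 ≤ ⌈(3 * k / 8 : ℝ)⌉₊ := Nat.ceil_pos.2 (by positivity)
  have ha2 := Nat.le_ceil (3 * k / 8 : ℝ)
  have hd1 : ⌈(3 * k / 2 : ℝ)⌉₊ ≤ 2 * k := Nat.ceil_le.2 (by push_cast; linarith)
  have hd2 := Nat.ceil_lt_add_one (show (0 : ℝ) ≤ 3 * k / 2 by positivity)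
  have had : ⌈(3 * k / 8 : ℝ)⌉₊ ≤ ⌈(3 * k / 2 : ℝ)⌉₊ := Nat.ceil_mono (by linarith)
  unfold segSum
  rw [Nat.floor_natCast]
  set a := ⌈(3 * k / 8 : ℝ)⌉₊
  set d := ⌈(3 * k / 2 : ℝ)⌉₊
  have hP := powerProb_nonneg α m (2 * k)
  have h1 : ∑ i ∈ Finset.Ico a d, powerProb α m i ≤
      (2 * k : ℕ) * ((16 / 3) ^ α * powerProb α m (2 * k)) := by
    have h : ∀ i ∈ Finset.Ico a d, powerProb α m i ≤ (16 / 3) ^ α * powerProb α m (2 * k) := by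
      intro i hi
      rw [Finset.mem_Ico] at hi
      have hai : (a : ℝ) ≤ i := by exact_mod_cast hi.1
      exact powerProb_le_mul hα m (ha1.trans hi.1) (by omega) (by norm_num) (by push_cast; linarith)
    refine (Finset.sum_le_card_nsmul _ _ _ h).trans ?_
    rw [nsmul_eq_mul, Nat.card_Ico]
    gcongr
    omega
  have h2 : k / 2 * powerProb α m (2 * k) ≤ ∑ i ∈ Finset.Icc d m, powerProb α m i := by
    calc k / 2 * powerProb α m (2 * k) ≤ (2 * k + 1 - d : ℕ) * powerProb α m (2 * k) := by
          gcongr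
          rw [Nat.cast_sub (by omega)]
          push_cast
          linarith
      _ = ∑ i ∈ Finset.Icc d (2 * k), powerProb α m (2 * k) := by
          rw [Finset.sum_const, Nat.card_Icc, nsmul_eq_mul]
      _ ≤ ∑ i ∈ Finset.Icc d (2 * k), powerProb α m i := by
          refine Finset.sum_le_sum fun i hi => ?_
          rw [Finset.mem_Icc] at hi
          exact powerProb_anti hα m (by omega) hi.2
      _ ≤ _ := Finset.sum_le_sum_of_subset_of_nonneg (Finset.Icc_subset_Icc_right hm)
          fun _ _ _ => powerProb_nonneg _ _ _
  have h3 : ∑ i ∈ Finset.Icc a m, powerProb α m i =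
      ∑ i ∈ Finset.Ico a d, powerProb α m i + ∑ i ∈ Finset.Icc d m, powerProb α m i := by
    rw [← Finset.Ico_add_one_right_eq_Icc, ← Finset.Ico_add_one_right_eq_Icc,
      Finset.sum_Ico_consecutive _ had (by omega)]
  have h4 := mul_le_mul_of_nonneg_left h2 (show (0 : ℝ) ≤ (16 / 3) ^ α by positivity)
  push_cast at h1
  rw [h3]
  linarith

/-- Both quotients are at least $p[3k/2:m]/p[3k/8:m]$. -/
theorem le_minExpr {α : ℝ} (hα : 0 ≤ α) {k m : ℕ} (hk : 1 ≤ k) (hm : 2 * k ≤ m) :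
    1 / (1 + 4 * (16 / 3) ^ α) ≤ minExpr (powerProb α m) k m := by
  have hk' : (1 : ℝ) ≤ k := by exact_mod_cast hk
  have hm' : 2 * (k : ℝ) ≤ m := by exact_mod_cast hm
  have h := segSum_le_mul hα hk hm
  have h38 := segSum_pos α (m := m) (x := 3 * k / 8) (by positivity) (by linarith)
  have h12 := segSum_pos α (m := m) (x := k / 2) (by positivity) (by linarith)
  have hK : (0 : ℝ) < 1 + 4 * (16 / 3) ^ α := by positivity
  refine le_min ?_ ?_
  · have h0 : 0 ≤ segSum (powerProb α m) (3 * k / 8) (k / 2) :=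
      Finset.sum_nonneg fun _ _ => powerProb_nonneg _ _ _
    rw [div_le_div_iff₀ hK h38]
    nlinarith
  · have h1 := segSum_anti α m (z := m) (show (11 * k / 8 : ℝ) ≤ 3 * k / 2 by linarith)
    have h2 := segSum_anti α m (z := m) (show (3 * k / 8 : ℝ) ≤ k / 2 by linarith)
    have h3 := mul_le_mul_of_nonneg_left h1 hK.le
    rw [div_le_div_iff₀ hK h12]
    linarith

/-! ### The explicit lower bound for cache sizes divisible by eight -/

theorem segSum_powerProb (α : ℝ) (m : ℕ) (x y : ℝ) :
    segSum (powerProb α m) x y =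
      1 / powerNorm α m * ∑ i ∈ Finset.Ico ⌈x⌉₊ (⌊y⌋₊ + 1), (i : ℝ) ^ (-α) := by
  rw [segSum, Finset.mul_sum, Finset.Ico_add_one_right_eq_Icc]
  refine Finset.sum_congr rfl fun i _ => ?_
  rw [powerProb, Real.rpow_neg (Nat.cast_nonneg i), one_div ((i : ℝ) ^ α)]

theorem minExpr_powerProb (α : ℝ) (j : ℕ) {m : ℕ} (hm : 1 ≤ m) :
    minExpr (powerProb α m) (8 * j) m =
      min ((∑ i ∈ Finset.Ico (3 * j) (4 * j + 1), (i : ℝ) ^ (-α) +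
          ∑ i ∈ Finset.Ico (12 * j) (m + 1), (i : ℝ) ^ (-α)) /
          ∑ i ∈ Finset.Ico (3 * j) (m + 1), (i : ℝ) ^ (-α))
        ((∑ i ∈ Finset.Ico (11 * j) (m + 1), (i : ℝ) ^ (-α)) /
          ∑ i ∈ Finset.Ico (4 * j) (m + 1), (i : ℝ) ^ (-α)) := by
  have hL : 1 / powerNorm α m ≠ 0 := (one_div_pos.2 (powerNorm_pos α hm)).ne'
  have e1 : (3 * ((8 * j : ℕ) : ℝ) / 8) = ((3 * j : ℕ) : ℝ) := by push_cast; ring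
  have e2 : (((8 * j : ℕ) : ℝ) / 2) = ((4 * j : ℕ) : ℝ) := by push_cast; ring
  have e3 : (3 * ((8 * j : ℕ) : ℝ) / 2) = ((12 * j : ℕ) : ℝ) := by push_cast; ring
  have e4 : (11 * ((8 * j : ℕ) : ℝ) / 8) = ((11 * j : ℕ) : ℝ) := by push_cast; ring
  rw [minExpr, e1, e2, e3, e4]
  simp only [segSum_powerProb, Nat.ceil_natCast, Nat.floor_natCast, ← mul_add,
    mul_div_mul_left _ _ hL]

theorem one_sub_powInt_div_le {α : ℝ} (hα : 0 ≤ α) {j m : ℕ} (hj : 1 ≤ j) (hm : 16 * j ≤ m) :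
    1 - powInt α 4 12 / powInt α 3 16 ≤
      (∑ i ∈ Finset.Ico (3 * j) (4 * j + 1), (i : ℝ) ^ (-α) +
          ∑ i ∈ Finset.Ico (12 * j) (m + 1), (i : ℝ) ^ (-α)) /
        ∑ i ∈ Finset.Ico (3 * j) (m + 1), (i : ℝ) ^ (-α) := by
  have hj' : 0 < (j : ℝ) := by exact_mod_cast hj
  -- The numerator is the full sum minus the gap strictly between $4j$ and $12j$.
  have hsum : ∑ i ∈ Finset.Ico (3 * j) (4 * j + 1), (i : ℝ) ^ (-α) +
      ∑ i ∈ Finset.Ico (12 * j) (m + 1), (i : ℝ) ^ (-α) =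
      ∑ i ∈ Finset.Ico (3 * j) (m + 1), (i : ℝ) ^ (-α) -
        ∑ i ∈ Finset.Ico (4 * j + 1) (12 * j), (i : ℝ) ^ (-α) := by
    rw [← Finset.sum_Ico_consecutive _ (show 3 * j ≤ 4 * j + 1 by omega)
      (show 4 * j + 1 ≤ m + 1 by omega),
      ← Finset.sum_Ico_consecutive _ (show 4 * j + 1 ≤ 12 * j by omega)
      (show 12 * j ≤ m + 1 by omega)]
    ring
  have hS := sum_rpow_pos α (show 1 ≤ 3 * j by omega) (show 3 * j < m + 1 by omega)
  have hM : ∑ i ∈ Finset.Ico (4 * j + 1) (12 * j), (i : ℝ) ^ (-α) ≤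
      (j : ℝ) ^ (1 - α) * powInt α 4 12 := by
    rw [← powInt_mul α hj' (by norm_num) (by norm_num)]
    have h := sum_le_powInt hα (show 1 ≤ 4 * j by omega) (show 4 * j ≤ 12 * j by omega)
    rw [mul_comm (j : ℝ), mul_comm (j : ℝ)]
    push_cast at h
    exact (sum_rpow_mono α le_rfl (by omega)).trans h
  have hT : (j : ℝ) ^ (1 - α) * powInt α 3 16 ≤
      ∑ i ∈ Finset.Ico (3 * j) (m + 1), (i : ℝ) ^ (-α) := by
    rw [← powInt_mul α hj' (by norm_num) (by norm_num)]
    have h := powInt_le_sum hα (show 1 ≤ 3 * j by omega) (show 3 * j ≤ 16 * j by omega)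
    rw [mul_comm (j : ℝ), mul_comm (j : ℝ)]
    push_cast at h
    exact h.trans (sum_rpow_mono α le_rfl (by omega))
  rw [hsum, sub_div, div_self hS.ne']
  have hJ : 0 < (j : ℝ) ^ (1 - α) := by positivity
  have hI : 0 < powInt α 3 16 := powInt_pos α (by norm_num) (by norm_num)
  have hI' : 0 < powInt α 4 12 := powInt_pos α (by norm_num) (by norm_num)
  refine sub_le_sub_left ?_ 1
  rw [div_le_div_iff₀ hS hI]
  have h1 := mul_le_mul_of_nonneg_right hM hI.le
  have h2 := mul_le_mul_of_nonneg_left hT hI'.le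
  linarith

theorem mul_sum_le_mul_sum {α : ℝ} (hα : 0 ≤ α) {j m : ℕ} (hj : 1 ≤ j) (hm : 16 * j ≤ m) :
    powInt α 3 4 * ∑ i ∈ Finset.Ico (4 * j) (11 * j), (i : ℝ) ^ (-α) ≤
      powInt α 1 3 * ∑ i ∈ Finset.Ico (11 * j) (m + 1), (i : ℝ) ^ (-α) := by
  have h34 : 0 < powInt α 3 4 := powInt_pos α (by norm_num) (by norm_num)
  have h13 : 0 < powInt α 1 3 := powInt_pos α (by norm_num) (by norm_num)
  rcases hj.eq_or_lt with rfl | hj2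
  · exact (mul_sum_le_mul_sum_one hα).trans
      (mul_le_mul_of_nonneg_left (sum_rpow_mono α le_rfl (by omega)) h13.le)
  · have hj' : (2 : ℝ) ≤ j := by exact_mod_cast hj2
    -- The midpoint bound starts at $c=4j-1/2$. Then $3c\ge 11j-1/2$ covers the middle segment,
    -- while $[3c,4c]\subseteq[11j,16j]$ needs $3c\ge 11j$, which fails for $j=1$.
    obtain ⟨c, hc⟩ : ∃ c : ℝ, c = 4 * j - 1 / 2 := ⟨_, rfl⟩
    have hc0 : 0 < c := by linarith
    have hB : ∑ i ∈ Finset.Ico (4 * j) (11 * j), (i : ℝ) ^ (-α) ≤ c ^ (1 - α) * powInt α 1 3 := by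
      rw [← powInt_mul α hc0 one_pos (by norm_num)]
      refine (sum_le_powInt_sub_half hα (by omega) (by omega)).trans
        (powInt_mono α (by linarith) ?_ ?_ ?_) <;> push_cast <;> linarith
    have hT : c ^ (1 - α) * powInt α 3 4 ≤
        ∑ i ∈ Finset.Ico (11 * j) (m + 1), (i : ℝ) ^ (-α) := by
      rw [← powInt_mul α hc0 (by norm_num) (by norm_num)]
      have h := powInt_le_sum hα (show 1 ≤ 11 * j by omega) (show 11 * j ≤ 16 * j by omega)
      refine (powInt_mono α ?_ ?_ ?_ ?_).trans (h.trans (sum_rpow_mono α le_rfl (by omega))) <;>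
        push_cast <;> linarith
    have h1 := mul_le_mul_of_nonneg_left hB h34.le
    have h2 := mul_le_mul_of_nonneg_left hT h13.le
    linarith

theorem one_le_log_eleven_div_four : 1 ≤ Real.log (11 / 4) := by
  rw [Real.le_log_iff_exp_le (by norm_num)]
  have := Real.exp_one_lt_d9
  linarith

/-- The logarithms are the limits of the two sums as $j\to\infty$ with $m=16j$, so errors of order
$1/j$ must be compared: the middle sum exceeds its limit by at most $1/(11j)$, and the tail gains at
least $1/(17j)$. -/
theorem log_mul_sum_le_log_mul_sum {j m : ℕ} (hj : 1 ≤ j) (hm : 16 * j ≤ m) :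
    Real.log (16 / 11) * ∑ i ∈ Finset.Ico (4 * j) (11 * j), (i : ℝ) ^ (-1 : ℝ) ≤
      Real.log (11 / 4) * ∑ i ∈ Finset.Ico (11 * j) (m + 1), (i : ℝ) ^ (-1 : ℝ) := by
  have hj' : (1 : ℝ) ≤ j := by exact_mod_cast hj
  have hj0 : (0 : ℝ) < j := by linarith
  have hx := one_le_log_eleven_div_four
  have hy : Real.log (16 / 11) ≤ 5 / 11 := by
    have := Real.log_le_sub_one_of_pos (show (0 : ℝ) < 16 / 11 by norm_num)
    linarith
  have hy0 : 0 ≤ Real.log (16 / 11) := Real.log_nonneg (by norm_num)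
  have hB : ∑ i ∈ Finset.Ico (4 * j) (11 * j), (i : ℝ) ^ (-1 : ℝ) ≤
      Real.log (11 / 4) + 1 / (11 * j) := by
    have h := sum_le_powInt_sub_half zero_le_one (show 1 ≤ 4 * j by omega)
      (show 4 * j ≤ 11 * j by omega)
    push_cast at h
    rw [powInt_one (by linarith) (by linarith), show ((11 : ℝ) * j - 1 / 2) / (4 * j - 1 / 2) =
      11 / 4 * ((88 * j - 4) / (88 * j - 11)) by
        have : (4 * j - 1 / 2 : ℝ) ≠ 0 := by linarith
        have : (88 * j - 11 : ℝ) ≠ 0 := by linarith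
        rw [div_mul_div_comm, div_eq_div_iff ‹_› (by simpa)]
        ring,
      Real.log_mul (by norm_num) (div_pos (by linarith) (by linarith)).ne'] at h
    have h1 := Real.log_le_sub_one_of_pos
      (show (0 : ℝ) < (88 * j - 4) / (88 * j - 11) from div_pos (by linarith) (by linarith))
    have h2 : (88 * j - 4 : ℝ) / (88 * j - 11) - 1 ≤ 1 / (11 * j) := by
      rw [div_sub_one (by linarith), div_le_div_iff₀ (by linarith) (by linarith)]
      linarith
    linarith
  have hT : Real.log (16 / 11) + 1 / (17 * j) ≤
      ∑ i ∈ Finset.Ico (11 * j) (m + 1), (i : ℝ) ^ (-1 : ℝ) := by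
    -- The endpoint $16j+1$, allowed because the term at $16j$ is included, supplies the gain.
    have h := powInt_le_sum zero_le_one (show 1 ≤ 11 * j by omega)
      (show 11 * j ≤ 16 * j + 1 by omega)
    push_cast at h
    rw [powInt_one (by linarith) (by linarith), show ((16 : ℝ) * j + 1) / (11 * j) =
      16 / 11 * ((16 * j + 1) / (16 * j)) by field_simp,
      Real.log_mul (by norm_num) (by positivity)] at h
    have h1 := Real.one_sub_inv_le_log_of_pos (show (0 : ℝ) < (16 * j + 1) / (16 * j) by positivity)
    have h2 : 1 / (17 * j : ℝ) ≤ 1 - ((16 * j + 1) / (16 * j) : ℝ)⁻¹ := by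
      rw [inv_div, one_sub_div (by positivity), div_le_div_iff₀ (by positivity) (by positivity)]
      linarith
    have h3 := sum_rpow_mono 1 (le_refl (11 * j)) (show 16 * j + 1 ≤ m + 1 by omega)
    linarith
  have h1 := mul_le_mul_of_nonneg_left hB hy0
  have h2 := mul_le_mul_of_nonneg_left hT (zero_le_one.trans hx)
  have h3 : Real.log (16 / 11) * (1 / (11 * j)) ≤ Real.log (11 / 4) * (1 / (17 * j)) := by
    rw [mul_one_div, mul_one_div, div_le_div_iff₀ (by positivity) (by positivity)]
    nlinarith
  linarith

theorem div_le_sum_div {α x y : ℝ} (hx : 0 < x) (hy : 0 < y) {j m : ℕ} (hj : 1 ≤ j)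
    (hm : 16 * j ≤ m)
    (h : y * ∑ i ∈ Finset.Ico (4 * j) (11 * j), (i : ℝ) ^ (-α) ≤
      x * ∑ i ∈ Finset.Ico (11 * j) (m + 1), (i : ℝ) ^ (-α)) :
    y / (x + y) ≤ (∑ i ∈ Finset.Ico (11 * j) (m + 1), (i : ℝ) ^ (-α)) /
      ∑ i ∈ Finset.Ico (4 * j) (m + 1), (i : ℝ) ^ (-α) := by
  rw [div_le_div_iff₀ (by linarith) (sum_rpow_pos α (by omega) (by omega)),
    ← Finset.sum_Ico_consecutive _ (show 4 * j ≤ 11 * j by omega)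
      (show 11 * j ≤ m + 1 by omega)]
  linarith

/-! ### Closed forms of the integral bounds, and their positivity -/

theorem lowerBound_le_of_ne {α : ℝ} (hα : α ≠ 1) :
    lowerBound α ≤ min (1 - powInt α 4 12 / powInt α 3 16)
      (powInt α 3 4 / (powInt α 1 3 + powInt α 3 4)) := by
  rw [powInt_add α one_pos (by norm_num) (by norm_num)]
  rcases lt_or_gt_of_ne hα with h | h
  · have hI : 0 < powInt α 1 4 := powInt_pos α one_pos (by norm_num)
    have hne : 1 - α ≠ 0 := by linarith
    have h13 : ((3 : ℝ) ^ (1 - α) - 1) / ((4 : ℝ) ^ (1 - α) - 1) = powInt α 1 3 / powInt α 1 4 := by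
      rw [powInt_eq hα one_pos (by norm_num), powInt_eq hα one_pos (by norm_num),
        div_div_div_cancel_right₀ hne, Real.one_rpow]
    have h4 : 0 < (4 : ℝ) ^ (1 - α) := by positivity
    rw [lowerBound, if_neg h.not_gt, if_neg hα, h13]
    refine le_min (sub_le_sub_left ?_ 1) (le_of_eq ?_)
    · have e1 := powInt_mul α (a := 1) (b := 3) (c := 4) (by norm_num) one_pos (by norm_num)
      have e2 := powInt_mul α (a := 1) (b := 4) (c := 4) (by norm_num) one_pos (by norm_num)
      norm_num at e1 e2
      rw [← mul_div_mul_left (powInt α 1 3) _ h4.ne', ← e1, ← e2]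
      have h1 : 0 < powInt α 4 16 := powInt_pos α (by norm_num) (by norm_num)
      have h2 : 0 < powInt α 4 12 := powInt_pos α (by norm_num) (by norm_num)
      have h3 : powInt α 4 16 ≤ powInt α 3 16 :=
        powInt_mono α (by norm_num) (by norm_num) (by norm_num) le_rfl
      gcongr
    · rw [← powInt_add α one_pos (b := 3) (c := 4) (by norm_num) (by norm_num)] at hI ⊢
      field_simp
      ring
  · rw [lowerBound, if_pos h]
    obtain ⟨β, rfl⟩ : ∃ β, α = β + 1 := ⟨α - 1, by ring⟩
    have hβ : 0 < β := by linarith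
    simp only [add_sub_cancel_right]
    have h2 : (1 : ℝ) < 2 ^ β := Real.one_lt_rpow (by norm_num) hβ
    have h3 : (1 : ℝ) < 3 ^ β := Real.one_lt_rpow (by norm_num) hβ
    have h163 : (1 : ℝ) < (16 / 3) ^ β := Real.one_lt_rpow (by norm_num) hβ
    -- In terms of $a=2^\beta$ and $s=3^\beta$ both equalities become rational identities.
    have e16 : (16 : ℝ) ^ β = (2 ^ β) ^ 4 := by
      rw [Real.rpow_pow_comm (by norm_num)]; norm_num
    have e8 : (8 : ℝ) ^ β = (2 ^ β) ^ 3 := by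
      rw [Real.rpow_pow_comm (by norm_num)]; norm_num
    have e4 : (4 : ℝ) ^ β = (2 ^ β) ^ 2 := by
      rw [Real.rpow_pow_comm (by norm_num)]; norm_num
    have e12 : (12 : ℝ) ^ β = (2 ^ β) ^ 2 * 3 ^ β := by
      rw [← e4, ← Real.mul_rpow (by norm_num) (by norm_num)]; norm_num
    simp only [powInt_eq hα one_pos (show (0 : ℝ) < 4 by norm_num),
      powInt_eq hα (show (0 : ℝ) < 4 by norm_num) (show (0 : ℝ) < 12 by norm_num),
      powInt_eq hα (show (0 : ℝ) < 3 by norm_num) (show (0 : ℝ) < 16 by norm_num),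
      powInt_eq hα (show (0 : ℝ) < 3 by norm_num) (show (0 : ℝ) < 4 by norm_num),
      show 1 - (β + 1) = -β by ring, div_div_div_cancel_right₀ (neg_ne_zero.2 hβ.ne')]
    rw [Real.div_rpow (by norm_num) (by norm_num)] at h163
    simp only [Real.rpow_neg (show (0 : ℝ) ≤ 3 by norm_num),
      Real.rpow_neg (show (0 : ℝ) ≤ 4 by norm_num), Real.rpow_neg (show (0 : ℝ) ≤ 12 by norm_num),
      Real.rpow_neg (show (0 : ℝ) ≤ 16 by norm_num), Real.one_rpow,
      Real.div_rpow (show (0 : ℝ) ≤ 2 by norm_num) (show (0 : ℝ) ≤ 3 by norm_num),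
      Real.div_rpow (show (0 : ℝ) ≤ 8 by norm_num) (show (0 : ℝ) ≤ 3 by norm_num),
      Real.div_rpow (show (0 : ℝ) ≤ 1 by norm_num) (show (0 : ℝ) ≤ 2 by norm_num),
      Real.div_rpow (show (0 : ℝ) ≤ 4 by norm_num) (show (0 : ℝ) ≤ 3 by norm_num),
      e4, e8, e12, e16] at h163 ⊢
    generalize (2 : ℝ) ^ β = a at *
    generalize (3 : ℝ) ^ β = s at *
    have ha : 0 < a := by linarith
    have hs : 0 < s := by linarith
    have h16 : s < a ^ 4 := by rwa [lt_div_iff₀ hs, one_mul] at h163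
    have ha2 : 1 < a ^ 2 := by nlinarith
    refine le_of_eq (congrArg₂ min ?_ ?_)
    · congr 1
      have n1 : a ^ 3 / s - 1 / a ≠ 0 := by
        have : a ^ 3 / s - 1 / a = (a ^ 4 - s) / (s * a) := by field_simp
        rw [this]
        exact (div_pos (by linarith) (by positivity)).ne'
      have n2 : (a ^ 4)⁻¹ - s⁻¹ ≠ 0 := by
        have : (a ^ 4)⁻¹ - s⁻¹ = (s - a ^ 4) / (a ^ 4 * s) := by field_simp
        rw [this]
        exact (div_neg_of_neg_of_pos (by linarith) (by positivity)).ne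
      rw [div_eq_div_iff n1 n2]
      field_simp
      ring
    · have n1 : a ^ 2 - 1 ≠ 0 := by linarith
      have n2 : (a ^ 2)⁻¹ - 1 ≠ 0 := (sub_neg.2 (inv_lt_one_of_one_lt₀ ha2)).ne
      rw [div_eq_div_iff n1 n2]
      field_simp
      ring

theorem lowerBound_one_le :
    lowerBound 1 ≤ min (1 - powInt 1 4 12 / powInt 1 3 16)
      (Real.log (16 / 11) / (Real.log (11 / 4) + Real.log (16 / 11))) := by
  have h4 : 0 < Real.log 4 := Real.log_pos (by norm_num)
  have e4 : Real.log (11 / 4) + Real.log (16 / 11) = Real.log 4 := by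
    rw [← Real.log_mul (by norm_num) (by norm_num)]; norm_num
  have e11 : Real.log 11 = Real.log (11 / 4) + Real.log 4 := by
    rw [← Real.log_mul (by norm_num) (by norm_num)]; norm_num
  have hLB : lowerBound 1 = 1 - Real.log (11 / 4) / Real.log 4 := by
    rw [lowerBound, if_neg (lt_irrefl _), if_pos rfl, e11, add_div, div_self h4.ne']
    ring
  rw [hLB]
  refine le_min (sub_le_sub_left ?_ 1) (le_of_eq ?_)
  · rw [powInt_one (by norm_num) (by norm_num), powInt_one (by norm_num) (by norm_num)]
    have e3 : Real.log (12 / 4) = Real.log (11 / 4) + Real.log (12 / 11) := by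
      rw [← Real.log_mul (by norm_num) (by norm_num)]; norm_num
    have e16 : Real.log (16 / 3) = Real.log 4 + Real.log (4 / 3) := by
      rw [← Real.log_mul (by norm_num) (by norm_num)]; norm_num
    have h1211 := Real.log_le_sub_one_of_pos (show (0 : ℝ) < 12 / 11 by norm_num)
    have h43 := Real.one_sub_inv_le_log_of_pos (show (0 : ℝ) < 4 / 3 by norm_num)
    have hx := one_le_log_eleven_div_four
    have h4' : Real.log 4 ≤ 2 := by
      have e : Real.log 4 = Real.log 2 + Real.log 2 := by
        rw [← Real.log_mul (by norm_num) (by norm_num)]; norm_num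
      linarith [Real.log_two_lt_d9]
    -- What remains is $\log\frac{12}{11}\log 4\le\log\frac{11}{4}\log\frac43$; the bounds give
    -- $2/11$ against $1/4$.
    rw [e3, e16, div_le_div_iff₀ (by linarith) h4]
    nlinarith
  · rw [e4, eq_div_iff h4.ne', sub_mul, div_mul_cancel₀ _ h4.ne']
    linarith

theorem lowerBound_le_minExpr {α : ℝ} (hα : 0 < α) {k m : ℕ} (hk : 1 ≤ k) (h8 : 8 ∣ k)
    (hm : 2 * k ≤ m) : lowerBound α ≤ minExpr (powerProb α m) k m := by
  obtain ⟨j, rfl⟩ := h8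
  rw [minExpr_powerProb α j (by omega)]
  have hj : 1 ≤ j := by omega
  have hm' : 16 * j ≤ m := by omega
  have h1 := one_sub_powInt_div_le hα.le hj hm'
  by_cases h : α = 1
  · subst h
    exact lowerBound_one_le.trans (min_le_min h1 (div_le_sum_div (Real.log_pos (by norm_num))
      (Real.log_pos (by norm_num)) hj hm' (log_mul_sum_le_log_mul_sum hj hm')))
  · exact (lowerBound_le_of_ne h).trans (min_le_min h1
      (div_le_sum_div (powInt_pos α one_pos (by norm_num)) (powInt_pos α (by norm_num)
        (by norm_num)) hj hm' (mul_sum_le_mul_sum hα.le hj hm')))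

theorem lowerBound_pos (α : ℝ) : 0 < lowerBound α := by
  unfold lowerBound
  split_ifs with h h'
  · have hβ : 0 < α - 1 := by linarith
    have hlt {x y : ℝ} (hx : 0 ≤ x) (hxy : x < y) : x ^ (α - 1) < y ^ (α - 1) :=
      Real.rpow_lt_rpow hx hxy hβ
    have h1 := hlt (show (0 : ℝ) ≤ 2 by norm_num) (show (2 : ℝ) < 8 / 3 by norm_num)
    have h2 := hlt (show (0 : ℝ) ≤ 1 / 2 by norm_num) (show (1 / 2 : ℝ) < 2 / 3 by norm_num)
    have h3 := hlt (show (0 : ℝ) ≤ 2 / 3 by norm_num) (show (2 / 3 : ℝ) < 2 by norm_num)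
    have h4 : (1 : ℝ) < (4 / 3) ^ (α - 1) := Real.one_lt_rpow (by norm_num) hβ
    have h5 : (1 : ℝ) < 4 ^ (α - 1) := Real.one_lt_rpow (by norm_num) hβ
    refine lt_min (sub_pos.2 ?_) (div_pos (by linarith) (by linarith))
    rw [div_lt_one (by linarith)]
    linarith
  · rw [sub_pos, div_lt_iff₀ (Real.log_pos (by norm_num))]
    have e : 2 * Real.log 4 = Real.log 16 := by
      rw [two_mul, ← Real.log_mul (by norm_num) (by norm_num)]; norm_num
    rw [e]
    exact Real.log_lt_log (by norm_num) (by norm_num)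
  · have hγ : 0 < 1 - α := by
      rcases lt_or_gt_of_ne h' with h'' | h''
      · linarith
      · exact absurd h'' h
    have h4 : (1 : ℝ) < 4 ^ (1 - α) := Real.one_lt_rpow (by norm_num) hγ
    rw [sub_pos, div_lt_one (by linarith)]
    exact sub_lt_sub_right (Real.rpow_lt_rpow (by norm_num) (by norm_num) hγ) 1

end Paging

theorem mainTheorem5 (α : ℝ) (hα : 0 < α) :
    0 < Paging.lowerBound α ∧
    (∀ k m : ℕ, 1 ≤ k → 8 ∣ k → 2 * k ≤ m →
      Paging.lowerBound α ≤ Paging.minExpr (Paging.powerProb α m) k m) ∧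
    (∃ c : ℝ, 0 < c ∧ ∀ k m : ℕ, 1 ≤ k → 2 * k ≤ m →
      c ≤ Paging.minExpr (Paging.powerProb α m) k m) ∧
    (∃ C : ℝ, ∀ k m : ℕ, 1 ≤ k → 2 * k ≤ m →
      Paging.roeLRU (Paging.powerLaw α m) k ≤ ENNReal.ofReal C) ∧
    (∃ C : ℝ, ∀ k m : ℕ, 1 ≤ k → 2 * k ≤ m →
      Paging.roePLFU (Paging.powerLaw α m) k ≤ ENNReal.ofReal C) :=
  ⟨Paging.lowerBound_pos α,
    fun _ _ hk h8 hm => Paging.lowerBound_le_minExpr hα hk h8 hm,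
    ⟨_, by positivity, fun _ _ hk hm => Paging.le_minExpr hα.le hk hm⟩,
    ⟨_, fun _ _ hk hm => Paging.roeLRU_le hα.le hk hm rfl⟩,
    ⟨_, fun _ _ hk hm => Paging.roePLFU_le hα.le hk hm rfl⟩⟩
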